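/- All graphs are finite and simple. A plane triangulation is a connected plane graph in which every face, the outer face included, is bounded by a triangle. A subgraph of an edge-coloured graph is rainbow if all its edges have different colours. For a graph $H$ and a positive integer $n$, the planar anti-Ramsey number $ar_{\mathcal{P}}(n,H)$ is the maximum number of colours in an edge-colouring, without a rainbow copy of $H$, of a plane triangulation on $n$ vertices that contains a subgraph isomorphic to $H$. Let $C_5$ denote the cycle on $5$ vertices. Theorem. Let $n\ge 119$ be an integer and let $r$ be the remainder of $n+7$ on division by $18$. Then $$ar_{\mathcal{P}}(n,C_5)\ \ge\ \frac{39n-123-21r}{18}.$$ -/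

import Mathlib

/-- A rotation system (combinatorial embedding in an oriented surface) of a simple graph `G`:
`rot` sends each dart (oriented edge) to the next dart, in the cyclic order given by the
orientation, among the darts with the same initial vertex. -/
structure RotationSystem {V : Type*} (G : SimpleGraph V) where
  rot : Equiv.Perm G.Dart
  rot_fst : ∀ d : G.Dart, (rot d).fst = d.fst
  sameCycle_of_fst_eq : ∀ d d' : G.Dart, d.fst = d'.fst → rot.SameCycle d d'

namespace RotationSystem

variable {V : Type*} {G : SimpleGraph V}

/-- The face permutation: traverse the dart `d`, then continue with the dart that follows the
reversal of `d` in the rotation at the terminal vertex of `d`. Its cycles are the facial walks. -/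
def facePerm (R : RotationSystem G) : Equiv.Perm G.Dart :=
  (Function.Involutive.toPerm SimpleGraph.Dart.symm SimpleGraph.Dart.symm_involutive).trans R.rot

/-- A face is a cycle of the face permutation. -/
def Face (R : RotationSystem G) : Type _ :=
  Quotient (Equiv.Perm.SameCycle.setoid R.facePerm)

/-- The size of the face that contains the dart `d`, that is, the length of its facial walk. -/
noncomputable def faceSize (R : RotationSystem G) (d : G.Dart) : ℕ :=
  Function.minimalPeriod R.facePerm d

/-- The embedding is an embedding in the sphere (equivalently, in the plane): the graph is
connected and has Euler characteristic `|V| - |E| + |F| = 2`. -/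
def IsPlane (R : RotationSystem G) : Prop :=
  G.Connected ∧ Nat.card V + Nat.card R.Face = Nat.card G.edgeSet + 2

end RotationSystem

namespace SimpleGraph

/-- `T` is (the underlying graph of) a plane triangulation: it has a plane embedding in which
every face, the outer one included, has size `3`. As `T` is simple, a facial walk of
length `3` is a triangle. -/
def IsPlaneTriangulation {V : Type*} (T : SimpleGraph V) : Prop :=
  ∃ R : RotationSystem T, R.IsPlane ∧ ∀ d : T.Dart, R.faceSize d = 3

/-- The edge-colouring `c` of `T` has a rainbow copy of `H`: a subgraph of `T` isomorphic to `H`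
all of whose edges have different colours. -/
def HasRainbowCopy {V W K : Type*} {T : SimpleGraph V} (c : T.EdgeLabeling K)
    (H : SimpleGraph W) : Prop :=
  ∃ f : H.Copy T, Function.Injective fun e : H.edgeSet => c (f.mapEdgeSet e)

/-- The numbers `k` such that some plane triangulation on `n` vertices that contains a copy of `H`
has an edge-colouring with exactly `k` colours and no rainbow copy of `H`. -/
def rainbowFreeColorCounts {W : Type*} (n : ℕ) (H : SimpleGraph W) : Set ℕ :=
  {k | ∃ T : SimpleGraph (Fin n), T.IsPlaneTriangulation ∧ H.IsContained T ∧
    ∃ c : T.EdgeLabeling (Fin k), Function.Surjective c ∧ ¬ HasRainbowCopy c H}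

/-- The set of attainable numbers of colours is bounded, so that its supremum in `ℕ` is a maximum
as soon as it is non-empty. -/
theorem bddAbove_rainbowFreeColorCounts {W : Type*} (n : ℕ) (H : SimpleGraph W) :
    BddAbove (rainbowFreeColorCounts n H) := by
  refine ⟨Nat.card (Sym2 (Fin n)), ?_⟩
  rintro k ⟨T, -, -, c, hc, -⟩
  calc k = Nat.card (Fin k) := by simp
    _ ≤ Nat.card T.edgeSet := Nat.card_le_card_of_surjective c hc
    _ ≤ Nat.card (Sym2 (Fin n)) :=
      Nat.card_le_card_of_injective _ Subtype.val_injective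

/-- The planar anti-Ramsey number of `H`: the maximum number of colours in an edge-colouring,
without a rainbow copy of `H`, of a plane triangulation on `n` vertices that contains `H`. -/
noncomputable def planarAntiRamsey {W : Type*} (n : ℕ) (H : SimpleGraph W) : ℕ :=
  sSup (rainbowFreeColorCounts n H)

end SimpleGraph

/-! Choose a set of vertices called hubs. Every edge that meets a hub takes the colour of its
largest hub, and every other edge has a private colour. On a five-cycle through a hub, the two edges
at its largest hub agree, so a rainbow five-cycle would avoid all hubs. It therefore suffices that
the graph on the non-hubs has no five-cycle; the number of colours is then the number of non-hub
edges plus the number of hubs.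

The non-hub graph is assembled from copies of `K₄` (blocks). The base has 29 vertices, 3 hubs and 9
blocks, hence 54 + 3 = 57 colours. It is extended at a hub `z` of degree 9 (`IsTube.extend`): a hub
of degree 6 is split off, its link is closed by a new vertex, and two blocks are attached at that
vertex. This adds 6 vertices and 12 + 1 colours, and `z` has degree 9 again. A five-cycle leaving a
single block would need a short path between the attachment vertices `p` and `q`. The distance
conditions in `IsTubeGraph` exclude this, and `IsTubeGraph.glue` shows that they reproduce
themselves for the next attachment vertices.

The remaining `r` vertices are inserted as hubs of degree 3, each worth one colour. With `n = 29 +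
18k + r` this gives `57 + 39k + r` colours.

Triangulations are handled as finite sets of oriented triangles, where face subdivisions and
diagonal flips suffice for all surgery. They are converted to rotation systems by
`IsTriangulationOn.isPlaneTriangulation`. -/

/-! ### Combinatorial triangulations, face subdivision and diagonal flip. -/

/-- A combinatorial triangulation of the sphere with vertices `0, …, n - 1`, given by the set `F` of
its oriented triangles, each listed with all three starting points. -/
structure IsTriangulationOn (n : ℕ) (F : Finset (ℕ × ℕ × ℕ)) : Prop where
  lt : ∀ {a b c}, (a, b, c) ∈ F → a < n
  ne : ∀ {a b c}, (a, b, c) ∈ F → a ≠ b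
  rotate : ∀ {a b c}, (a, b, c) ∈ F → (b, c, a) ∈ F
  unique : ∀ {a b c c'}, (a, b, c) ∈ F → (a, b, c') ∈ F → c = c'
  next : ∀ {a b c}, (a, b, c) ∈ F → ∃ d, (a, c, d) ∈ F
  link : ∀ {a b c b' c'}, (a, b, c) ∈ F → (a, b', c') ∈ F →
    Relation.ReflTransGen (fun x y => (a, x, y) ∈ F) b b'
  connected : ∀ S : ℕ → Prop, S 0 → (∀ a b c, (a, b, c) ∈ F → S a → S b) → ∀ a < n, S a
  card : F.card + 12 = 6 * n

/-- Adjacency in the graph formed by the sides of the triangles in `F`. -/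
def SideAdj (F : Finset (ℕ × ℕ × ℕ)) (x y : ℕ) : Prop := ∃ w, (x, y, w) ∈ F

/-- The three rotations of an oriented triangle. -/
def triangleRotations (a b c : ℕ) : Finset (ℕ × ℕ × ℕ) := {(a, b, c), (b, c, a), (c, a, b)}

theorem mem_triangleRotations {a b c x y w : ℕ} : (x, y, w) ∈ triangleRotations a b c ↔
    (x = a ∧ y = b ∧ w = c) ∨ (x = b ∧ y = c ∧ w = a) ∨ (x = c ∧ y = a ∧ w = b) := by
  simp [triangleRotations]

theorem card_triangleRotations {a b c : ℕ} (hab : a ≠ b) (hbc : b ≠ c) (hca : c ≠ a) :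
    (triangleRotations a b c).card = 3 := by
  rw [Finset.card_eq_three]
  exact ⟨_, _, _, by simp [hab], by simp [hca.symm], by simp [hbc], rfl⟩

namespace IsTriangulationOn

variable {n : ℕ} {F : Finset (ℕ × ℕ × ℕ)}

theorem lt_snd (h : IsTriangulationOn n F) {a b c : ℕ} (ht : (a, b, c) ∈ F) : b < n :=
  h.lt (h.rotate ht)

theorem lt_trd (h : IsTriangulationOn n F) {a b c : ℕ} (ht : (a, b, c) ∈ F) : c < n :=
  h.lt (h.rotate (h.rotate ht))

theorem sideAdj_symm (h : IsTriangulationOn n F) {x y : ℕ} (hxy : SideAdj F x y) :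
    SideAdj F y x := by
  obtain ⟨w, hw⟩ := hxy
  obtain ⟨d, hd⟩ := h.next (h.rotate (h.rotate (h.rotate (h.rotate hw))))
  exact ⟨d, hd⟩

set_option maxHeartbeats 2000000 in
/-- Subdividing the face `a b c` by a new vertex `n`. -/
theorem subdivide (h : IsTriangulationOn n F) {a b c : ℕ} (ht : (a, b, c) ∈ F) :
    ∃ F', IsTriangulationOn (n + 1) F' ∧
      (a, b, n) ∈ F' ∧ (b, c, n) ∈ F' ∧ (c, a, n) ∈ F' ∧
      (∀ x y w, (x, y, w) ∈ F → ¬(x = a ∧ y = b) → ¬(x = b ∧ y = c) → ¬(x = c ∧ y = a) →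
        (x, y, w) ∈ F') ∧
      ∀ x y, SideAdj F' x y ↔ SideAdj F x y ∨ (x = n ∧ (y = a ∨ y = b ∨ y = c)) ∨
        (y = n ∧ (x = a ∨ x = b ∨ x = c)) := by
  have ht2 := h.rotate ht
  have ht3 := h.rotate ht2
  have han := h.lt ht
  have hbn := h.lt ht2
  have hcn := h.lt ht3
  have hab := h.ne ht
  have hbc := h.ne ht2
  have hca := h.ne ht3
  have hu := @h.unique
  have hlt := @h.lt
  have hlt2 := @h.lt_snd
  have hlt3 := @h.lt_trd
  have hne := @h.ne
  have hr := @h.rotate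
  -- One triangle is replaced by three, each counted with its three rotations: the cardinality grows
  -- by 6, as `card` demands for one more vertex.
  obtain ⟨F', hmem, hcard⟩ : ∃ F' : Finset (ℕ × ℕ × ℕ), (∀ x y w, (x, y, w) ∈ F' ↔
      ((x, y, w) ∈ F ∧ (x, y, w) ∉ triangleRotations a b c) ∨ (x, y, w) ∈ triangleRotations a b n ∨
      (x, y, w) ∈ triangleRotations b c n ∨ (x, y, w) ∈ triangleRotations c a n) ∧
      F'.card + 12 = 6 * (n + 1) := by
    refine ⟨(F \ triangleRotations a b c) ∪ (triangleRotations a b n ∪ (triangleRotations b c n ∪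
      triangleRotations c a n)), by simp, ?_⟩
    have c0 := card_triangleRotations hab hbc hca
    have c1 := card_triangleRotations hab (c := n) (by omega) (by omega)
    have c2 := card_triangleRotations hbc (c := n) (by omega) (by omega)
    have c3 := card_triangleRotations hca (c := n) (by omega) (by omega)
    have hsub : triangleRotations a b c ⊆ F := by
      rintro ⟨x, y, w⟩ hx
      rw [mem_triangleRotations] at hx
      rcases hx with ⟨rfl, rfl, rfl⟩ | ⟨rfl, rfl, rfl⟩ | ⟨rfl, rfl, rfl⟩ <;> assumption
    have hle := Finset.card_le_card hsub
    have hcard := h.card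
    rw [Finset.card_union_of_disjoint, Finset.card_union_of_disjoint,
      Finset.card_union_of_disjoint, Finset.card_sdiff_of_subset hsub, c0, c1, c2, c3]
    · omega
    all_goals
      rw [Finset.disjoint_left]
      rintro ⟨x, y, w⟩ hx
      simp only [Finset.mem_union, Finset.mem_sdiff, mem_triangleRotations] at hx ⊢
    · rcases hx with hx | hx | hx <;> grind
    · rcases hx with hx | hx | hx <;> grind
    · have := @hlt x y w
      have := @hlt2 x y w
      have := @hlt3 x y w
      grind
  simp only [mem_triangleRotations] at hmem
  have hE : ∀ x y w, (x, y, w) ∈ F' → ((x, y, w) ∈ F ∧ ¬ (x = a ∧ y = b) ∧ ¬ (x = b ∧ y = c) ∧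
      ¬ (x = c ∧ y = a)) ∨
      (x = a ∧ y = b ∧ w = n) ∨ (x = b ∧ y = n ∧ w = a) ∨ (x = n ∧ y = a ∧ w = b) ∨
      (x = b ∧ y = c ∧ w = n) ∨ (x = c ∧ y = n ∧ w = b) ∨ (x = n ∧ y = b ∧ w = c) ∨
      (x = c ∧ y = a ∧ w = n) ∨ (x = a ∧ y = n ∧ w = c) ∨ (x = n ∧ y = c ∧ w = a) := by
    intro x y w hx
    rcases (hmem x y w).1 hx with ⟨h1, h2⟩ | h1 | h1 | h1
    · left
      grind
    all_goals
      right
      rcases h1 with ⟨rfl, rfl, rfl⟩ | ⟨rfl, rfl, rfl⟩ | ⟨rfl, rfl, rfl⟩ <;> simp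
  have hO : ∀ x y w, (x, y, w) ∈ F → ¬ (x = a ∧ y = b) → ¬ (x = b ∧ y = c) →
      ¬ (x = c ∧ y = a) → (x, y, w) ∈ F' := by
    intro x y w hx h1 h2 h3
    refine (hmem x y w).2 (.inl ⟨hx, ?_⟩)
    rintro (h | h | h)
    exacts [h1 ⟨h.1, h.2.1⟩, h2 ⟨h.1, h.2.1⟩, h3 ⟨h.1, h.2.1⟩]
  have m1 : (a, b, n) ∈ F' := (hmem _ _ _).2 (by simp)
  have m2 : (b, n, a) ∈ F' := (hmem _ _ _).2 (by simp)
  have m3 : (n, a, b) ∈ F' := (hmem _ _ _).2 (by simp)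
  have m4 : (b, c, n) ∈ F' := (hmem _ _ _).2 (by simp)
  have m5 : (c, n, b) ∈ F' := (hmem _ _ _).2 (by simp)
  have m6 : (n, b, c) ∈ F' := (hmem _ _ _).2 (by simp)
  have m7 : (c, a, n) ∈ F' := (hmem _ _ _).2 (by simp)
  have m8 : (a, n, c) ∈ F' := (hmem _ _ _).2 (by simp)
  have m9 : (n, c, a) ∈ F' := (hmem _ _ _).2 (by simp)
  clear hmem
  have hadj : ∀ x y, SideAdj F' x y ↔ SideAdj F x y ∨ (x = n ∧ (y = a ∨ y = b ∨ y = c)) ∨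
        (y = n ∧ (x = a ∨ x = b ∨ x = c)) := by
    intro x y
    constructor
    · rintro ⟨w, hw⟩
      rcases hE _ _ _ hw with h | h | h | h | h | h | h | h | h | h
      · exact .inl ⟨w, h.1⟩
      · exact .inl ⟨c, h.1 ▸ h.2.1 ▸ ht⟩
      · right; grind
      · right; grind
      · exact .inl ⟨a, h.1 ▸ h.2.1 ▸ ht2⟩
      · right; grind
      · right; grind
      · exact .inl ⟨b, h.1 ▸ h.2.1 ▸ ht3⟩
      · right; grind
      · right; grind
    · rintro (⟨w, hw⟩ | ⟨rfl, rfl | rfl | rfl⟩ | ⟨rfl, rfl | rfl | rfl⟩)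
      · by_cases h1 : x = a ∧ y = b
        · exact ⟨n, h1.1 ▸ h1.2 ▸ m1⟩
        by_cases h2 : x = b ∧ y = c
        · exact ⟨n, h2.1 ▸ h2.2 ▸ m4⟩
        by_cases h3 : x = c ∧ y = a
        · exact ⟨n, h3.1 ▸ h3.2 ▸ m7⟩
        exact ⟨w, hO _ _ _ hw h1 h2 h3⟩
      all_goals exact ⟨_, by assumption⟩
  refine ⟨F', ?_, m1, m4, m7, hO, hadj⟩
  have hrot' : ∀ x y w, (x, y, w) ∈ F' → (y, w, x) ∈ F' := by
    intro x y w hw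
    rcases hE _ _ _ hw with h | h | h | h | h | h | h | h | h | h <;> grind
  have hadjs : ∀ x y, SideAdj F' x y → SideAdj F' y x := by
    intro x y
    rw [hadj, hadj]
    have := h.sideAdj_symm (x := x) (y := y)
    grind
  -- A step in an old link across the subdivided face becomes two steps through `n`.
  have hlift : ∀ x p q, (x, p, q) ∈ F → Relation.ReflTransGen (fun u v => (x, u, v) ∈ F') p q := by
    intro x p q hpq
    by_cases h1 : (x = a ∧ p = b) ∨ (x = b ∧ p = c) ∨ (x = c ∧ p = a)
    · refine (Relation.ReflTransGen.single (b := n) ?_).trans (Relation.ReflTransGen.single ?_)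
      · grind
      · grind
    · exact Relation.ReflTransGen.single (hO _ _ _ hpq (by tauto) (by tauto) (by tauto))
  have hold : ∀ x p p', SideAdj F x p → SideAdj F x p' →
      Relation.ReflTransGen (fun u v => (x, u, v) ∈ F') p p' := by
    rintro x p p' ⟨q, hq⟩ ⟨q', hq'⟩
    have := h.link hq hq'
    clear hq'
    induction this with
    | refl => exact .refl
    | tail _ h2 ih =>
      exact ih.trans (hlift _ _ _ h2)
  refine ⟨?_, ?_, @hrot', ?_, ?_, ?_, ?_, ?_⟩
  · intro x y w hw
    rcases hE _ _ _ hw with h | h | h | h | h | h | h | h | h | h <;> grind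
  · intro x y w hw
    rcases hE _ _ _ hw with h | h | h | h | h | h | h | h | h | h <;> grind
  · intro x y w w' hw hw'
    rcases hE _ _ _ hw with h | h | h | h | h | h | h | h | h | h <;>
      rcases hE _ _ _ hw' with k | k | k | k | k | k | k | k | k | k <;> grind
  · intro x y w hw
    exact hadjs _ _ ⟨y, hrot' _ _ _ (hrot' _ _ _ hw)⟩
  · intro x p q p' q' hp hp'
    have e1 : SideAdj F' x p := ⟨_, hp⟩
    have e2 : SideAdj F' x p' := ⟨_, hp'⟩
    rw [hadj] at e1 e2
    by_cases hxn : x = n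
    · have s1 : Relation.ReflTransGen (fun u v => (x, u, v) ∈ F') a b :=
        .single (by grind)
      have s2 : Relation.ReflTransGen (fun u v => (x, u, v) ∈ F') b c :=
        .single (by grind)
      have s3 : Relation.ReflTransGen (fun u v => (x, u, v) ∈ F') c a :=
        .single (by grind)
      have f1 : p = a ∨ p = b ∨ p = c := by
        rcases e1 with ⟨w, hw⟩ | e1 | e1 <;> grind
      have f2 : p' = a ∨ p' = b ∨ p' = c := by
        rcases e2 with ⟨w, hw⟩ | e1 | e1 <;> grind
      rcases f1 with rfl | rfl | rfl <;> rcases f2 with rfl | rfl | rfl <;>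
        first
        | exact .refl
        | assumption
        | exact s1.trans s2
        | exact s2.trans s3
        | exact s3.trans s1
    -- If an end of the link path is the new vertex, it is first moved to an adjacent old neighbour.
    · have g1 : ∃ u, SideAdj F x u ∧ Relation.ReflTransGen (fun u v => (x, u, v) ∈ F') p u := by
        by_cases hpn : p = n
        · have : x = a ∨ x = b ∨ x = c := by
            rcases e1 with ⟨w, hw⟩ | e1 | e1 <;> grind
          rcases this with rfl | rfl | rfl
          · exact ⟨c, h.next ht, .single (by grind)⟩
          · exact ⟨a, h.next ht2, .single (by grind)⟩
          · exact ⟨b, h.next ht3, .single (by grind)⟩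
        · exact ⟨p, by grind, .refl⟩
      have g2 : ∃ u, SideAdj F x u ∧ Relation.ReflTransGen (fun u v => (x, u, v) ∈ F') u p' := by
        by_cases hpn : p' = n
        · have : x = a ∨ x = b ∨ x = c := by
            rcases e2 with ⟨w, hw⟩ | e1 | e1 <;> grind
          rcases this with rfl | rfl | rfl
          · exact ⟨b, ⟨_, ht⟩, .single (by grind)⟩
          · exact ⟨c, ⟨_, ht2⟩, .single (by grind)⟩
          · exact ⟨a, ⟨_, ht3⟩, .single (by grind)⟩
        · exact ⟨p', by grind, .refl⟩
      obtain ⟨u, hu1, hu2⟩ := g1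
      obtain ⟨v, hv1, hv2⟩ := g2
      exact hu2.trans ((hold x u v hu1 hv1).trans hv2)
  · intro S h0 hS
    have hS' : ∀ x y, SideAdj F' x y → S x → S y := fun x y ⟨w, hw⟩ => hS x y w hw
    have hall := h.connected S h0 (fun x y w hw => hS' x y ((hadj x y).2 (.inl ⟨w, hw⟩)))
    intro x hx
    by_cases hxn : x = n
    · subst hxn
      exact hS' a x ((hadj a x).2 (by simp)) (hall a han)
    · exact hall x (by omega)
  · exact hcard

set_option maxHeartbeats 2000000 in
/-- Flipping the diagonal `z x₁` of the quadrilateral `z x₀ x₁ x₂` to `x₀ x₂`. -/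
theorem flip (h : IsTriangulationOn n F) {z x₀ x₁ x₂ : ℕ} (ht : (z, x₀, x₁) ∈ F)
    (hs : (z, x₁, x₂) ∈ F) (hne : x₀ ≠ x₂) (hnadj : ¬ SideAdj F x₀ x₂) :
    ∃ F', IsTriangulationOn n F' ∧ (z, x₀, x₂) ∈ F' ∧ (x₀, x₁, x₂) ∈ F' ∧
      (∀ x y w, (x, y, w) ∈ F → ¬(x = z ∧ y = x₀) → ¬(x = z ∧ y = x₁) → ¬(x = x₀ ∧ y = x₁) →
        ¬(x = x₁ ∧ y = z) → ¬(x = x₁ ∧ y = x₂) → ¬(x = x₂ ∧ y = z) → (x, y, w) ∈ F') ∧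
      ∀ x y, SideAdj F' x y ↔ (SideAdj F x y ∧ ¬(x = z ∧ y = x₁) ∧ ¬(x = x₁ ∧ y = z)) ∨
        (x = x₀ ∧ y = x₂) ∨ (x = x₂ ∧ y = x₀) := by
  have hnadj' : ¬ SideAdj F x₂ x₀ := fun h' => hnadj (h.sideAdj_symm h')
  have hna : ∀ w, (x₀, x₂, w) ∉ F := fun w hw => hnadj ⟨w, hw⟩
  have hna' : ∀ w, (x₂, x₀, w) ∉ F := fun w hw => hnadj' ⟨w, hw⟩
  have ht2 := h.rotate ht
  have ht3 := h.rotate ht2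
  have hs2 := h.rotate hs
  have hs3 := h.rotate hs2
  have n1 := h.ne ht
  have n2 := h.ne ht2
  have n3 := h.ne ht3
  have n4 := h.ne hs2
  have n5 := h.ne hs3
  have hlt := @h.lt
  have hne' := @h.ne
  have hr := @h.rotate
  have hu := @h.unique
  obtain ⟨F', hmem, hcard⟩ : ∃ F' : Finset (ℕ × ℕ × ℕ), (∀ x y w, (x, y, w) ∈ F' ↔
      ((x, y, w) ∈ F ∧ ¬ ((x, y, w) ∈ triangleRotations z x₀ x₁ ∨
        (x, y, w) ∈ triangleRotations z x₁ x₂)) ∨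
      (x, y, w) ∈ triangleRotations z x₀ x₂ ∨ (x, y, w) ∈ triangleRotations x₀ x₁ x₂) ∧
      F'.card + 12 = 6 * n := by
    refine ⟨(F \ (triangleRotations z x₀ x₁ ∪ triangleRotations z x₁ x₂)) ∪
      (triangleRotations z x₀ x₂ ∪ triangleRotations x₀ x₁ x₂), fun x y w => by
        simp only [Finset.mem_union, Finset.mem_sdiff], ?_⟩
    have c0 := card_triangleRotations n1 n2 n3
    have c1 := card_triangleRotations n3.symm n4 n5
    have c2 := card_triangleRotations n1 hne n5
    have c3 := card_triangleRotations n2 n4 hne.symm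
    have hsub : triangleRotations z x₀ x₁ ∪ triangleRotations z x₁ x₂ ⊆ F := by
      rintro ⟨x, y, w⟩ hx
      rw [Finset.mem_union, mem_triangleRotations, mem_triangleRotations] at hx
      rcases hx with (⟨rfl, rfl, rfl⟩ | ⟨rfl, rfl, rfl⟩ | ⟨rfl, rfl, rfl⟩) |
        (⟨rfl, rfl, rfl⟩ | ⟨rfl, rfl, rfl⟩ | ⟨rfl, rfl, rfl⟩) <;> assumption
    have hun : (triangleRotations z x₀ x₁ ∪ triangleRotations z x₁ x₂).card = 6 := by
      rw [Finset.card_union_of_disjoint, c0, c1]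
      rw [Finset.disjoint_left]
      rintro ⟨x, y, w⟩ hx
      simp only [mem_triangleRotations] at hx ⊢
      rcases hx with hx | hx | hx <;> grind
    have hle := Finset.card_le_card hsub
    have hcard := h.card
    rw [Finset.card_union_of_disjoint, Finset.card_union_of_disjoint,
      Finset.card_sdiff_of_subset hsub, hun, c2, c3]
    · omega
    all_goals
      rw [Finset.disjoint_left]
      rintro ⟨x, y, w⟩ hx
      simp only [Finset.mem_union, Finset.mem_sdiff, mem_triangleRotations] at hx ⊢
    · rcases hx with hx | hx | hx <;> grind
    · rintro ((hy | hy | hy) | (hy | hy | hy)) <;> grind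
  simp only [mem_triangleRotations] at hmem
  have hE : ∀ x y w, (x, y, w) ∈ F' → ((x, y, w) ∈ F ∧ ¬(x = z ∧ y = x₀) ∧ ¬(x = z ∧ y = x₁) ∧
      ¬(x = x₀ ∧ y = x₁) ∧ ¬(x = x₁ ∧ y = z) ∧ ¬(x = x₁ ∧ y = x₂) ∧ ¬(x = x₂ ∧ y = z)) ∨
      (x = z ∧ y = x₀ ∧ w = x₂) ∨ (x = x₀ ∧ y = x₂ ∧ w = z) ∨ (x = x₂ ∧ y = z ∧ w = x₀) ∨
      (x = x₀ ∧ y = x₁ ∧ w = x₂) ∨ (x = x₁ ∧ y = x₂ ∧ w = x₀) ∨ (x = x₂ ∧ y = x₀ ∧ w = x₁) := by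
    intro x y w hx
    rcases (hmem x y w).1 hx with ⟨h1, h2⟩ | h1 | h1
    · left
      refine ⟨h1, ?_, ?_, ?_, ?_, ?_, ?_⟩ <;> rintro ⟨rfl, rfl⟩ <;> apply h2
      · simp [hu h1 ht]
      · simp [hu h1 hs]
      · simp [hu h1 ht2]
      · simp [hu h1 ht3]
      · simp [hu h1 hs2]
      · simp [hu h1 hs3]
    all_goals
      right
      rcases h1 with ⟨rfl, rfl, rfl⟩ | ⟨rfl, rfl, rfl⟩ | ⟨rfl, rfl, rfl⟩ <;> simp
  have hO : ∀ x y w, (x, y, w) ∈ F → ¬(x = z ∧ y = x₀) → ¬(x = z ∧ y = x₁) →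
      ¬(x = x₀ ∧ y = x₁) → ¬(x = x₁ ∧ y = z) → ¬(x = x₁ ∧ y = x₂) → ¬(x = x₂ ∧ y = z) →
      (x, y, w) ∈ F' := by
    intro x y w hx h1 h2 h3 h4 h5 h6
    refine (hmem x y w).2 (.inl ⟨hx, ?_⟩)
    rintro ((h | h | h) | (h | h | h))
    exacts [h1 ⟨h.1, h.2.1⟩, h3 ⟨h.1, h.2.1⟩, h4 ⟨h.1, h.2.1⟩, h2 ⟨h.1, h.2.1⟩, h5 ⟨h.1, h.2.1⟩,
      h6 ⟨h.1, h.2.1⟩]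
  have m1 : (z, x₀, x₂) ∈ F' := (hmem _ _ _).2 (by simp)
  have m2 : (x₀, x₂, z) ∈ F' := (hmem _ _ _).2 (by simp)
  have m3 : (x₂, z, x₀) ∈ F' := (hmem _ _ _).2 (by simp)
  have m4 : (x₀, x₁, x₂) ∈ F' := (hmem _ _ _).2 (by simp)
  have m5 : (x₁, x₂, x₀) ∈ F' := (hmem _ _ _).2 (by simp)
  have m6 : (x₂, x₀, x₁) ∈ F' := (hmem _ _ _).2 (by simp)
  clear hmem
  have hadj : ∀ x y, SideAdj F' x y ↔ (SideAdj F x y ∧ ¬(x = z ∧ y = x₁) ∧ ¬(x = x₁ ∧ y = z)) ∨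
        (x = x₀ ∧ y = x₂) ∨ (x = x₂ ∧ y = x₀) := by
    intro x y
    constructor
    · rintro ⟨w, hw⟩
      rcases hE _ _ _ hw with h | h | h | h | h | h | h
      · exact .inl ⟨⟨w, h.1⟩, h.2.2.1, h.2.2.2.2.1⟩
      · exact .inl ⟨⟨x₁, h.1 ▸ h.2.1 ▸ ht⟩, by grind, by grind⟩
      · exact .inr (.inl ⟨h.1, h.2.1⟩)
      · exact .inl ⟨⟨x₁, h.1 ▸ h.2.1 ▸ hs3⟩, by grind, by grind⟩
      · exact .inl ⟨⟨z, h.1 ▸ h.2.1 ▸ ht2⟩, by grind, by grind⟩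
      · exact .inl ⟨⟨z, h.1 ▸ h.2.1 ▸ hs2⟩, by grind, by grind⟩
      · exact .inr (.inr ⟨h.1, h.2.1⟩)
    · rintro (⟨⟨w, hw⟩, h1, h2⟩ | ⟨rfl, rfl⟩ | ⟨rfl, rfl⟩)
      · by_cases h3 : x = z ∧ y = x₀
        · exact ⟨x₂, h3.1 ▸ h3.2 ▸ m1⟩
        by_cases h4 : x = x₀ ∧ y = x₁
        · exact ⟨x₂, h4.1 ▸ h4.2 ▸ m4⟩
        by_cases h5 : x = x₁ ∧ y = x₂
        · exact ⟨x₀, h5.1 ▸ h5.2 ▸ m5⟩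
        by_cases h6 : x = x₂ ∧ y = z
        · exact ⟨x₀, h6.1 ▸ h6.2 ▸ m3⟩
        exact ⟨w, hO _ _ _ hw h3 h1 h4 h2 h5 h6⟩
      · exact ⟨z, m2⟩
      · exact ⟨x₁, m6⟩
  refine ⟨F', ?_, m1, m4, hO, hadj⟩
  have hrot' : ∀ x y w, (x, y, w) ∈ F' → (y, w, x) ∈ F' := by
    intro x y w hw
    rcases hE _ _ _ hw with h | h | h | h | h | h | h
    · have h' := hr h.1
      refine hO _ _ _ h' ?_ ?_ ?_ ?_ ?_ ?_
      · rintro ⟨rfl, rfl⟩; have := hu h' ht; grind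
      · rintro ⟨rfl, rfl⟩; have := hu h' hs; grind
      · rintro ⟨rfl, rfl⟩; have := hu h' ht2; grind
      · rintro ⟨rfl, rfl⟩; have := hu h' ht3; grind
      · rintro ⟨rfl, rfl⟩; have := hu h' hs2; grind
      · rintro ⟨rfl, rfl⟩; have := hu h' hs3; grind
    all_goals grind
  have hadjs : ∀ x y, SideAdj F' x y → SideAdj F' y x := by
    intro x y
    rw [hadj, hadj]
    have := h.sideAdj_symm (x := x) (y := y)
    grind
  refine ⟨?_, ?_, @hrot', ?_, ?_, ?_, ?_, ?_⟩
  · intro x y w hw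
    rcases hE _ _ _ hw with h | h | h | h | h | h | h <;> grind
  · intro x y w hw
    rcases hE _ _ _ hw with h | h | h | h | h | h | h <;> grind
  · intro x y w w' hw hw'
    rcases hE _ _ _ hw with h | h | h | h | h | h | h <;>
      rcases hE _ _ _ hw' with k | k | k | k | k | k | k <;> grind
  · intro x y w hw
    exact hadjs _ _ ⟨y, hrot' _ _ _ (hrot' _ _ _ hw)⟩
  · -- the neighbour that is deleted from the link of `x` is replaced by its predecessor
    have key : ∀ x p p', SideAdj F x p → SideAdj F x p' → ¬(x = z ∧ p = x₁) → ¬(x = x₁ ∧ p = z) →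
        ∀ v, v = (if x = z ∧ p' = x₁ then x₀ else if x = x₁ ∧ p' = z then x₂ else p') →
        Relation.ReflTransGen (fun u v => (x, u, v) ∈ F') p v := by
      rintro x p p' ⟨q, hq⟩ ⟨q', hq'⟩ h1 h2
      have := h.link hq hq'
      clear hq'
      induction this with
      | refl => intro v hv; rw [if_neg h1, if_neg h2] at hv; rw [hv]
      | @tail u w _ huw ih =>
        intro v hv
        refine (ih _ rfl).trans ?_
        by_cases e1 : x = z ∧ w = x₁
        · rw [if_pos e1] at hv
          have : u = x₀ := by grind
          rw [if_neg (by grind), if_neg (by grind), hv, this]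
        by_cases e2 : x = x₁ ∧ w = z
        · rw [if_neg e1, if_pos e2] at hv
          have : u = x₂ := by grind
          rw [if_neg (by grind), if_neg (by grind), hv, this]
        rw [if_neg e1, if_neg e2] at hv
        subst hv
        by_cases e3 : x = z ∧ u = x₁
        · rw [if_pos e3]
          exact .single (by grind)
        by_cases e4 : x = x₁ ∧ u = z
        · rw [if_neg e3, if_pos e4]
          exact .single (by grind)
        rw [if_neg e3, if_neg e4]
        -- At `x₀` and `x₂` the new diagonal inserts a neighbour into the link, so one old step
        -- becomes two.
        by_cases e5 : x = x₀ ∧ u = x₁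
        · refine (Relation.ReflTransGen.single (b := x₂) ?_).trans (Relation.ReflTransGen.single ?_)
          · grind
          · grind
        by_cases e6 : x = x₂ ∧ u = z
        · refine (Relation.ReflTransGen.single (b := x₀) ?_).trans (Relation.ReflTransGen.single ?_)
          · grind
          · grind
        exact .single (by grind)
    intro x p q p' q' hp hp'
    have e1 : SideAdj F' x p := ⟨_, hp⟩
    have e2 : SideAdj F' x p' := ⟨_, hp'⟩
    rw [hadj] at e1 e2
    have g1 : ∃ u, SideAdj F x u ∧ ¬(x = z ∧ u = x₁) ∧ ¬(x = x₁ ∧ u = z) ∧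
        Relation.ReflTransGen (fun u v => (x, u, v) ∈ F') p u := by
      rcases e1 with ⟨e, h1, h2⟩ | ⟨rfl, rfl⟩ | ⟨rfl, rfl⟩
      · exact ⟨p, e, h1, h2, .refl⟩
      · exact ⟨z, h.sideAdj_symm ⟨_, ht⟩, by grind, by grind, .single (by grind)⟩
      · exact ⟨x₁, h.sideAdj_symm ⟨_, hs2⟩, by grind, by grind, .single (by grind)⟩
    have g2 : ∃ u, SideAdj F x u ∧ ¬(x = z ∧ u = x₁) ∧ ¬(x = x₁ ∧ u = z) ∧
        Relation.ReflTransGen (fun u v => (x, u, v) ∈ F') u p' := by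
      rcases e2 with ⟨e, h1, h2⟩ | ⟨rfl, rfl⟩ | ⟨rfl, rfl⟩
      · exact ⟨p', e, h1, h2, .refl⟩
      · exact ⟨x₁, ⟨_, ht2⟩, by grind, by grind, .single (by grind)⟩
      · exact ⟨z, ⟨_, hs3⟩, by grind, by grind, .single (by grind)⟩
    obtain ⟨u, hu1, hu2, hu3, hu4⟩ := g1
    obtain ⟨v, hv1, hv2, hv3, hv4⟩ := g2
    exact hu4.trans ((key x u v hu1 hv1 hu2 hu3 v (by rw [if_neg hv2, if_neg hv3])).trans hv4)
  · intro S h0 hS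
    have hS' : ∀ x y, SideAdj F' x y → S x → S y := fun x y ⟨w, hw⟩ => hS x y w hw
    have a1 : SideAdj F' z x₀ := ⟨x₂, by assumption⟩
    have a2 : SideAdj F' x₀ x₁ := ⟨x₂, by assumption⟩
    refine h.connected S h0 fun x y w hw hx => ?_
    -- The deleted diagonal is bypassed by the path `z x₀ x₁`, in either direction.
    by_cases e1 : x = z ∧ y = x₁
    · rw [e1.2]; exact hS' _ _ a2 (hS' _ _ a1 (e1.1 ▸ hx))
    by_cases e2 : x = x₁ ∧ y = z
    · rw [e2.2]; exact hS' _ _ (hadjs _ _ a1) (hS' _ _ (hadjs _ _ a2) (e2.1 ▸ hx))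
    exact hS' x y ((hadj x y).2 (.inl ⟨⟨w, hw⟩, e1, e2⟩)) hx
  · exact hcard

end IsTriangulationOn

/-! ### From oriented triangles to a plane rotation system. -/

/-- If all cycles of a permutation have length three, then there are three times as many points
as cycles. -/
theorem Equiv.Perm.three_mul_card_quotient_sameCycle {α : Type*} (σ : Equiv.Perm α)
    (h : ∀ x, Function.minimalPeriod σ x = 3) :
    3 * Nat.card (Quotient (Equiv.Perm.SameCycle.setoid σ)) = Nat.card α := by
  have hper (x : α) : σ (σ (σ x)) = x := by
    have := Function.iterate_minimalPeriod (f := σ) (x := x)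
    rw [h x] at this
    exact this
  have h1 (x : α) : σ x ≠ x := by
    intro h'
    have := Function.minimalPeriod_eq_one_iff_isFixedPt.2 h'
    have := h x
    omega
  have h3 : σ ^ 3 = 1 := Equiv.ext fun x => by
    simp [pow_succ, hper]
  have h2 : (σ ^ 2 : Equiv.Perm α) = σ * σ := pow_two σ
  have hcl (x y : α) (hs : σ.SameCycle x y) : y = x ∨ y = σ x ∨ y = σ (σ x) := by
    obtain ⟨i, hi⟩ := hs
    have hz : σ ^ i = σ ^ (i % 3) := by
      conv_lhs => rw [← Int.mul_ediv_add_emod i 3, zpow_add, zpow_mul]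
      rw [show σ ^ (3 : ℤ) = 1 from mod_cast h3, one_zpow, one_mul]
    rw [hz] at hi
    have := Int.emod_nonneg i (show (3 : ℤ) ≠ 0 by norm_num)
    have := Int.emod_lt_of_pos i (show (0 : ℤ) < 3 by norm_num)
    rcases (by omega : i % 3 = 0 ∨ i % 3 = 1 ∨ i % 3 = 2) with h' | h' | h' <;> rw [h'] at hi
    · exact .inl (by simpa using hi.symm)
    · exact .inr (.inl (by simpa using hi.symm))
    · refine .inr (.inr ?_)
      rw [show σ ^ (2 : ℤ) = σ * σ from mod_cast h2] at hi
      simpa using hi.symm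
  -- Every point is `σ ^ i` of its cycle's chosen representative for exactly one `i < 3`.
  let f : Quotient (Equiv.Perm.SameCycle.setoid σ) × Fin 3 → α := fun p => (σ ^ (p.2 : ℕ)) p.1.out
  have hf : Function.Bijective f := by
    constructor
    · rintro ⟨a, i⟩ ⟨b, j⟩ hab
      have hsame : a = b := by
        rw [← Quotient.out_eq a, ← Quotient.out_eq b]
        apply Quotient.sound
        have e1 : σ.SameCycle a.out (f (a, i)) := ⟨(i : ℕ), by simp [f]⟩
        have e2 : σ.SameCycle b.out (f (b, j)) := ⟨(j : ℕ), by simp [f]⟩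
        rw [hab] at e1
        exact e1.trans e2.symm
      subst hsame
      simp only [f] at hab
      generalize a.out = x at hab
      have g1 := h1 x
      have g2 := h1 (σ x)
      have g3 := h1 (σ (σ x))
      rw [hper] at g3
      fin_cases i <;> fin_cases j <;> simp [h2] at hab ⊢
      · exact g1 hab.symm
      · exact g3 hab
      · exact g1 hab
      · exact g1 hab.symm
      · exact g3 hab.symm
      · exact g1 hab
    · intro x
      have hs : σ.SameCycle (Quotient.mk (Equiv.Perm.SameCycle.setoid σ) x).out x :=
        Quotient.mk_out (s := Equiv.Perm.SameCycle.setoid σ) x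
      rcases hcl _ _ hs with h' | h' | h'
      · exact ⟨(Quotient.mk _ x, 0), by simpa [f] using h'.symm⟩
      · exact ⟨(Quotient.mk _ x, 1), by simpa [f] using h'.symm⟩
      · exact ⟨(Quotient.mk _ x, 2), by simpa [f, h2] using h'.symm⟩
  rw [← Nat.card_eq_of_bijective f hf, Nat.card_prod, Nat.card_fin, mul_comm]

namespace IsTriangulationOn

variable {n : ℕ} {F : Finset (ℕ × ℕ × ℕ)}

/-- The graph of a combinatorial triangulation. -/
def graph (h : IsTriangulationOn n F) : SimpleGraph (Fin n) where
  Adj i j := SideAdj F i j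
  symm := ⟨fun _ _ hij => h.sideAdj_symm hij⟩
  loopless := ⟨fun _ ⟨_, hw⟩ => h.ne hw rfl⟩

theorem exists_third (h : IsTriangulationOn n F) (d : h.graph.Dart) :
    ∃ c : Fin n, ((d.fst : ℕ), (d.snd : ℕ), (c : ℕ)) ∈ F := by
  obtain ⟨w, hw⟩ := d.adj
  exact ⟨⟨w, h.lt_trd hw⟩, hw⟩

/-- The third vertex of the triangle on a given dart. -/
noncomputable def third (h : IsTriangulationOn n F) (d : h.graph.Dart) : Fin n :=
  (h.exists_third d).choose

theorem third_mem (h : IsTriangulationOn n F) (d : h.graph.Dart) :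
    ((d.fst : ℕ), (d.snd : ℕ), (h.third d : ℕ)) ∈ F := (h.exists_third d).choose_spec

theorem third_eq (h : IsTriangulationOn n F) {d : h.graph.Dart} {c : Fin n}
    (hc : ((d.fst : ℕ), (d.snd : ℕ), (c : ℕ)) ∈ F) : h.third d = c :=
  Fin.ext (h.unique (h.third_mem d) hc)

/-- The dart that follows `d` around its initial vertex. -/
noncomputable def nextDart (h : IsTriangulationOn n F) (d : h.graph.Dart) : h.graph.Dart :=
  ⟨(d.fst, h.third d), h.next (h.third_mem d)⟩

/-- The dart that precedes `d` around its initial vertex. -/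
noncomputable def prevDart (h : IsTriangulationOn n F) (d : h.graph.Dart) : h.graph.Dart :=
  ⟨(d.fst, h.third d.symm), ⟨_, h.rotate (h.third_mem d.symm)⟩⟩

theorem prevDart_nextDart (h : IsTriangulationOn n F) (d : h.graph.Dart) :
    h.prevDart (h.nextDart d) = d := by
  refine SimpleGraph.Dart.ext _ _ (Prod.ext rfl ?_)
  exact h.third_eq (h.rotate (h.rotate (h.third_mem d)))

theorem nextDart_prevDart (h : IsTriangulationOn n F) (d : h.graph.Dart) :
    h.nextDart (h.prevDart d) = d := by
  refine SimpleGraph.Dart.ext _ _ (Prod.ext rfl ?_)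
  exact h.third_eq (h.rotate (h.third_mem d.symm))

/-- The rotation system of a combinatorial triangulation. -/
noncomputable def rotationSystem (h : IsTriangulationOn n F) : RotationSystem h.graph where
  rot := ⟨h.nextDart, h.prevDart, h.prevDart_nextDart, h.nextDart_prevDart⟩
  rot_fst _ := rfl
  sameCycle_of_fst_eq := by
    intro d d' hd
    have key : ∀ y, Relation.ReflTransGen (fun x y => ((d.fst : ℕ), x, y) ∈ F) d.snd y →
        ∀ e : h.graph.Dart, e.fst = d.fst → (e.snd : ℕ) = y →
        Equiv.Perm.SameCycle ⟨h.nextDart, h.prevDart, h.prevDart_nextDart, h.nextDart_prevDart⟩ d e := by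
      intro y hy
      induction hy with
      | refl =>
        intro e h1 h2
        rw [SimpleGraph.Dart.ext e d (Prod.ext h1 (Fin.ext h2))]
      | @tail u w _ huw ih =>
        intro e h1 h2
        refine (ih ⟨(d.fst, ⟨u, h.lt_snd huw⟩), ⟨w, huw⟩⟩ rfl rfl).trans ⟨1, ?_⟩
        refine SimpleGraph.Dart.ext _ _ (Prod.ext h1.symm ?_)
        exact h.third_eq (by simpa [h2] using huw)
    have h2 := h.third_mem d'
    rw [← hd] at h2
    exact key _ (h.link (h.third_mem d) h2) d' hd.symm rfl

theorem facePerm_apply (h : IsTriangulationOn n F) (d : h.graph.Dart) :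
    h.rotationSystem.facePerm d = h.nextDart d.symm := rfl

/-- If `(b, a, c)` is the oriented triangle on the reversal of the dart `(a, b)`, the face
permutation runs through `(a, b)`, `(b, c)`, `(c, a)`. It moves the initial vertex, so the period is
the prime 3 and not 1. -/
theorem faceSize_eq (h : IsTriangulationOn n F) (d : h.graph.Dart) :
    h.rotationSystem.faceSize d = 3 := by
  have hm := h.third_mem d.symm
  refine Function.minimalPeriod_eq_prime (p := 3) ?_ ?_
  · change h.rotationSystem.facePerm (h.rotationSystem.facePerm (h.rotationSystem.facePerm d)) = d
    have e2 : (h.nextDart (h.nextDart d.symm).symm).snd = d.fst :=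
      h.third_eq (h.rotate (h.rotate hm))
    refine SimpleGraph.Dart.ext _ _ (Prod.ext e2 ?_)
    refine h.third_eq ?_
    simp only [facePerm_apply]
    change (((h.nextDart (h.nextDart d.symm).symm).snd : ℕ), (h.third d.symm : ℕ), (d.snd : ℕ)) ∈ F
    rw [e2]
    exact h.rotate hm
  · intro hd
    have : (h.rotationSystem.facePerm d).fst = d.fst := by rw [hd]
    exact h.ne hm (congrArg Fin.val this)

/-- A dart extends to exactly one oriented triangle with a chosen starting point. -/
theorem card_dart (h : IsTriangulationOn n F) : Nat.card h.graph.Dart = F.card := by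
  rw [← Nat.card_eq_finsetCard]
  refine Nat.card_eq_of_bijective
    (fun d => (⟨(d.fst, d.snd, h.third d), h.third_mem d⟩ : F)) ⟨?_, ?_⟩
  · intro d e hde
    simp only [Subtype.mk.injEq, Prod.mk.injEq] at hde
    exact SimpleGraph.Dart.ext _ _ (Prod.ext (Fin.ext hde.1) (Fin.ext hde.2.1))
  · rintro ⟨⟨a, b, c⟩, habc⟩
    refine ⟨⟨(⟨a, h.lt habc⟩, ⟨b, h.lt_snd habc⟩), ⟨c, habc⟩⟩, ?_⟩
    simp only [Subtype.mk.injEq, Prod.mk.injEq, true_and]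
    exact h.unique (h.third_mem _) habc

theorem graph_connected (h : IsTriangulationOn n F) (hn : 0 < n) : h.graph.Connected := by
  have key := h.connected (fun a => ∀ ha : a < n, h.graph.Reachable ⟨0, hn⟩ ⟨a, ha⟩)
    (fun _ => .refl _) (fun a b c habc ha hb => (ha (h.lt habc)).trans
      (SimpleGraph.Adj.reachable (G := h.graph) ⟨c, habc⟩))
  have : Nonempty (Fin n) := ⟨⟨0, hn⟩⟩
  exact ⟨fun a b => (key a a.2 a.2).symm.trans (key b b.2 b.2)⟩

/-- Both `3 * |faces|` and `2 * |edges|` equal the number of darts, which is `F.card = 6 * n - 12`;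
Euler's formula follows. -/
theorem isPlaneTriangulation (h : IsTriangulationOn n F) (hn : 0 < n) :
    h.graph.IsPlaneTriangulation := by
  classical
  refine ⟨h.rotationSystem, ⟨h.graph_connected hn, ?_⟩, h.faceSize_eq⟩
  have h1 := h.rotationSystem.facePerm.three_mul_card_quotient_sameCycle h.faceSize_eq
  have h2 := h.graph.dart_card_eq_twice_card_edges
  have h3 := h.card_dart
  have h4 := h.card
  have h5 : Nat.card h.graph.edgeSet = h.graph.edgeFinset.card := by
    rw [Nat.card_eq_fintype_card, SimpleGraph.edgeFinset_card]
  rw [← Nat.card_eq_fintype_card] at h2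
  change 3 * Nat.card h.rotationSystem.Face = _ at h1
  rw [Nat.card_fin, h5]
  omega

end IsTriangulationOn

/-! ### Surgery at a hub. -/

namespace IsTriangulationOn

variable {n : ℕ} {F : Finset (ℕ × ℕ × ℕ)}

/-- Subdividing a face at `z`, with the information on the link of `z` made explicit. -/
theorem subdivide_link (h : IsTriangulationOn n F) {z p q : ℕ} (ht : (z, p, q) ∈ F) :
    ∃ F', IsTriangulationOn (n + 1) F' ∧ (z, p, n) ∈ F' ∧ (z, n, q) ∈ F' ∧ (p, q, n) ∈ F' ∧
      (∀ x y, (z, x, y) ∈ F → x ≠ p → (z, x, y) ∈ F') ∧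
      ∀ x y, SideAdj F' x y ↔ SideAdj F x y ∨ (x = n ∧ (y = z ∨ y = p ∨ y = q)) ∨
        (y = n ∧ (x = z ∨ x = p ∨ x = q)) := by
  obtain ⟨F', h', m1, m2, m3, hO, hadj⟩ := h.subdivide ht
  refine ⟨F', h', m1, h'.rotate m3, m2, fun x y hxy hx => hO _ _ _ hxy ?_ ?_ ?_, hadj⟩
  · exact fun e => hx e.2
  · exact fun e => h.ne ht e.1
  · exact fun e => h.ne (h.rotate (h.rotate ht)) e.1.symm

/-- Flipping an edge at `z`, with the information on the link of `z` made explicit. -/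
theorem flip_link (h : IsTriangulationOn n F) {z p q r : ℕ} (ht : (z, p, q) ∈ F)
    (hs : (z, q, r) ∈ F) (hne : p ≠ r) (hnadj : ¬ SideAdj F p r) :
    ∃ F', IsTriangulationOn n F' ∧ (z, p, r) ∈ F' ∧
      (∀ x y, (z, x, y) ∈ F → x ≠ p → x ≠ q → (z, x, y) ∈ F') ∧
      ∀ x y, SideAdj F' x y ↔ (SideAdj F x y ∧ ¬(x = z ∧ y = q) ∧ ¬(x = q ∧ y = z)) ∨
        (x = p ∧ y = r) ∨ (x = r ∧ y = p) := by
  obtain ⟨F', h', m1, m2, hO, hadj⟩ := h.flip ht hs hne hnadj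
  have n1 := h.ne ht
  have n2 := h.ne hs
  have n3 := h.ne (h.rotate (h.rotate hs))
  refine ⟨F', h', m1, fun x y hxy hx hx' => hO _ _ _ hxy ?_ ?_ ?_ ?_ ?_ ?_, hadj⟩ <;> grind

/-- Splitting off from `z` a new vertex `n` that takes over the neighbours `p₁, p₂, p₃`. -/
theorem split_four (h : IsTriangulationOn n F) {z p₀ p₁ p₂ p₃ p₄ : ℕ} (h₀ : (z, p₀, p₁) ∈ F)
    (h₁ : (z, p₁, p₂) ∈ F) (h₂ : (z, p₂, p₃) ∈ F) (h₃ : (z, p₃, p₄) ∈ F)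
    (hp : [p₀, p₁, p₂, p₃, p₄].Nodup) :
    ∃ F', IsTriangulationOn (n + 1) F' ∧ (z, p₀, n) ∈ F' ∧ (z, n, p₄) ∈ F' ∧
      (∀ x y, (z, x, y) ∈ F → x ≠ p₀ → x ≠ p₁ → x ≠ p₂ → x ≠ p₃ → (z, x, y) ∈ F') ∧
      SideAdj F' n p₀ ∧
      (∀ y, SideAdj F z y → y ≠ p₁ → y ≠ p₂ → y ≠ p₃ → SideAdj F' z y) ∧
      ∀ x y, x ≠ z → y ≠ z → x ≠ n → y ≠ n → (SideAdj F' x y ↔ SideAdj F x y) := by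
  have hfr (y : ℕ) : ¬ SideAdj F n y := fun ⟨w, hw⟩ => (h.lt hw).false
  have l0 := h.lt h₀
  have l1 := h.lt_snd h₀
  have l2 := h.lt_snd h₁
  have l3 := h.lt_snd h₂
  have l4 := h.lt_snd h₃
  have l5 := h.lt_trd h₃
  have z0 := h.ne h₀
  have z1 := h.ne h₁
  have z2 := h.ne h₂
  have z3 := h.ne h₃
  have z4 := h.ne (h.rotate (h.rotate h₃))
  simp only [List.nodup_cons, List.mem_cons, List.not_mem_nil, or_false, not_or,
    not_false_eq_true, List.nodup_nil, and_true] at hp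
  obtain ⟨⟨d1, d2, d3, d4⟩, ⟨d5, d6, d7⟩, ⟨d8, d9⟩, d10⟩ := hp
  -- The new vertex starts in the face `z p₀ p₁`. Flipping `z p₁`, `z p₂`, `z p₃` in turn transfers
  -- these neighbours to it; no flip creates a double edge, because `n` is not yet adjacent to the
  -- next vertex.
  obtain ⟨F₁, t1, a1, b1, -, r1, s1⟩ := h.subdivide_link h₀
  obtain ⟨F₂, t2, b2, r2, s2⟩ := t1.flip_link b1 (r1 _ _ h₁ (Ne.symm d1)) (by omega) (by
    rw [s1]; have := hfr p₂; grind)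
  obtain ⟨F₃, t3, b3, r3, s3⟩ := t2.flip_link b2
    (r2 _ _ (r1 _ _ h₂ (Ne.symm d2)) (by omega) (Ne.symm d5)) (by omega) (by
    rw [s2, s1]; have := hfr p₃; grind)
  obtain ⟨F₄, t4, b4, r4, s4⟩ := t3.flip_link b3
    (r3 _ _ (r2 _ _ (r1 _ _ h₃ (Ne.symm d3)) (by omega) (Ne.symm d6)) (by omega) (Ne.symm d8))
    (by omega) (by
    rw [s3, s2, s1]; have := hfr p₄; grind)
  refine ⟨F₄, t4, ?_, b4, ?_, ?_, ?_, ?_⟩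
  · exact r4 _ _ (r3 _ _ (r2 _ _ a1 (by omega) d1) (by omega) d2) (by omega) d3
  · intro x y hxy e0 e1 e2 e3
    have : x < n := h.lt_snd hxy
    exact r4 _ _ (r3 _ _ (r2 _ _ (r1 _ _ hxy e0) (by omega) e1) (by omega) e2) (by omega) e3
  · rw [s4, s3, s2, s1]
    grind
  · intro y hy e1 e2 e3
    rw [s4, s3, s2, s1]
    grind
  · intro x y e1 e2 e3 e4
    rw [s4, s3, s2, s1]
    grind

/-- The edges among non-hubs that are created when two blocks are glued to the vertices `p` and
`q`: the blocks are `q, n + 1, n + 2, n + 3` and `p, n + 1, n + 4, n + 5`. -/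
def BlockEdge (n p q x y : ℕ) : Prop :=
  (x = n + 1 ∧ (y = p ∨ y = q)) ∨ (x = n + 2 ∧ (y = q ∨ y = n + 1)) ∨
  (x = n + 3 ∧ (y = q ∨ y = n + 1 ∨ y = n + 2)) ∨ (x = n + 4 ∧ (y = p ∨ y = n + 1)) ∨
  (x = n + 5 ∧ (y = p ∨ y = n + 1 ∨ y = n + 4))

/-- Gluing two blocks into the face of the hub `z`, together with a new hub `n`. -/
theorem glue_blocks (h : IsTriangulationOn n F) {z p₀ p₁ p₂ p₃ p₄ : ℕ} (h₀ : (z, p₀, p₁) ∈ F)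
    (h₁ : (z, p₁, p₂) ∈ F) (h₂ : (z, p₂, p₃) ∈ F) (h₃ : (z, p₃, p₄) ∈ F)
    (hp : [p₀, p₁, p₂, p₃, p₄].Nodup) :
    ∃ F', IsTriangulationOn (n + 6) F' ∧
      (z, p₀, n + 2) ∈ F' ∧ (z, n + 2, n + 1) ∈ F' ∧ (z, n + 1, n + 4) ∈ F' ∧ (z, n + 4, p₄) ∈ F' ∧
      (∀ x y, (z, x, y) ∈ F → x ≠ p₀ → x ≠ p₁ → x ≠ p₂ → x ≠ p₃ → (z, x, y) ∈ F') ∧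
      SideAdj F' n p₀ ∧
      (∀ y, SideAdj F z y → y ≠ p₁ → y ≠ p₂ → y ≠ p₃ → SideAdj F' z y) ∧
      ∀ x y, x ≠ z → y ≠ z → x ≠ n → y ≠ n →
        (SideAdj F' x y ↔ SideAdj F x y ∨ BlockEdge n p₄ p₀ x y ∨ BlockEdge n p₄ p₀ y x) := by
  have l0 := h.lt h₀
  have l1 := h.lt_snd h₀
  have l5 := h.lt_trd h₃
  have z0 := h.ne h₀
  have z4 := h.ne (h.rotate (h.rotate h₃))
  obtain ⟨F₁, t1, a1, b1, r1, g1, k1, s1⟩ := h.split_four h₀ h₁ h₂ h₃ hp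
  simp only [List.nodup_cons, List.mem_cons, List.not_mem_nil, or_false, not_or,
    not_false_eq_true, List.nodup_nil, and_true] at hp
  have d4 := hp.1.2.2.2
  have hfr (y : ℕ) : ¬ SideAdj F₁ (n + 1) y := fun ⟨w, hw⟩ => (t1.lt hw).false
  -- Placing `n + 1` in the face `z p₀ n` and flipping `z n` to `(n + 1) p₄` separates the two hubs;
  -- the link of `n` is now the hexagon `p₀ p₁ p₂ p₃ p₄ (n + 1)`.
  obtain ⟨F₂, t2, a2, b2, -, r2, s2⟩ := t1.subdivide_link a1
  obtain ⟨F₃, t3, b3, r3, s3⟩ := t2.flip_link b2 (r2 _ _ b1 (by omega)) (by omega) (by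
    rw [s2]; have := hfr p₄; grind)
  have a3 := r3 _ _ a2 (by omega) (by omega)
  -- Two nested subdivisions on the side `p₀ (n + 1)` complete one `K₄`; two more on `(n + 1) p₄`
  -- complete the other.
  obtain ⟨F₄, t4, a4, b4, c4, r4, s4⟩ := t3.subdivide_link a3
  obtain ⟨F₅, t5, -, -, -, r5, s5⟩ := t4.subdivide c4
  have r5' : ∀ x y, (z, x, y) ∈ F₄ → (z, x, y) ∈ F₅ := fun x y hxy =>
    r5 z x y hxy (by omega) (by omega) (by omega)
  obtain ⟨F₆, t6, a6, b6, c6, r6, s6⟩ := t5.subdivide_link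
    (r5' _ _ (r4 _ _ b3 (by omega)))
  obtain ⟨F₇, t7, -, -, -, r7, s7⟩ := t6.subdivide c6
  have r7' : ∀ x y, (z, x, y) ∈ F₆ → (z, x, y) ∈ F₇ := fun x y hxy =>
    r7 z x y hxy (by omega) (by omega) (by omega)
  simp only [Nat.add_assoc, Nat.reduceAdd] at *
  refine ⟨F₇, t7, ?_, ?_, r7' _ _ a6, r7' _ _ b6, ?_, ?_, ?_, ?_⟩
  · exact r7' _ _ (r6 _ _ (r5' _ _ a4) (by omega))
  · exact r7' _ _ (r6 _ _ (r5' _ _ b4) (by omega))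
  · intro x y hxy e0 e1 e2 e3
    have : x < n := h.lt_snd hxy
    refine r7' _ _ (r6 _ _ (r5' _ _ (r4 _ _ (r3 _ _ (r2 _ _ (r1 _ _ hxy e0 e1 e2 e3) e0) ?_ ?_)
      e0)) ?_) <;> omega
  · rw [s7, s6, s5, s4, s3, s2]
    grind
  · intro y hy e1 e2 e3
    have hyn : y ≠ n := by
      obtain ⟨w, hw⟩ := hy
      exact (h.lt_snd hw).ne
    have := k1 y hy e1 e2 e3
    rw [s7, s6, s5, s4, s3, s2]
    grind
  · intro x y e1 e2 e3 e4
    rw [s7, s6, s5, s4, s3, s2, s1 x y e1 e2 e3 e4]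
    simp only [e1, e2, e3, e4, BlockEdge, and_false, not_false_eq_true, and_true,
      false_or, or_false]
    clear * -
    constructor <;> intro h <;> grind (splits := 30)

end IsTriangulationOn

/-! ### Five-cycles and distances in the non-hub graph. -/

/-- A relation without cycles of length five. -/
def NoFiveCycle (G : ℕ → ℕ → Prop) : Prop :=
  ∀ a b c d e, [a, b, c, d, e].Nodup → G a b → G b c → G c d → G d e → G e a → False

/-- A five-cycle may be read from its largest vertex. When vertices are added in increasing order,
that vertex has few candidates for its two smaller neighbours. -/
theorem NoFiveCycle.of_max {G : ℕ → ℕ → Prop}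
    (h : ∀ v a b c d, [a, b, c, d].Nodup → a < v → b < v → c < v → d < v →
      G v a → G a b → G b c → G c d → G d v → False) : NoFiveCycle G := by
  intro a b c d e hn h1 h2 h3 h4 h5
  simp only [List.nodup_cons, List.mem_cons, List.not_mem_nil, or_false, not_or,
    not_false_eq_true, List.nodup_nil, and_true] at hn h
  obtain ⟨⟨d1, d2, d3, d4⟩, ⟨d5, d6, d7⟩, ⟨d8, d9⟩, d10⟩ := hn
  by_cases ha : b < a ∧ c < a ∧ d < a ∧ e < a
  · exact h a b c d e (by grind) ha.1 ha.2.1 ha.2.2.1 ha.2.2.2 h1 h2 h3 h4 h5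
  by_cases hb : c < b ∧ d < b ∧ e < b ∧ a < b
  · exact h b c d e a (by grind) hb.1 hb.2.1 hb.2.2.1 hb.2.2.2 h2 h3 h4 h5 h1
  by_cases hc : d < c ∧ e < c ∧ a < c ∧ b < c
  · exact h c d e a b (by grind) hc.1 hc.2.1 hc.2.2.1 hc.2.2.2 h3 h4 h5 h1 h2
  by_cases hd : e < d ∧ a < d ∧ b < d ∧ c < d
  · exact h d e a b c (by grind) hd.1 hd.2.1 hd.2.2.1 hd.2.2.2 h4 h5 h1 h2 h3
  exact h e a b c d (by grind) (by omega) (by omega) (by omega) (by omega) h5 h1 h2 h3 h4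

/-- A symmetric relation on `{0, …, n - 1}` without five-cycles in which the distance of `p` and `q`
is at least four, that of `p` and `r` at least three and that of `q` and `r` at least two. -/
structure IsTubeGraph (n : ℕ) (G : ℕ → ℕ → Prop) (p q r : ℕ) : Prop where
  symm : ∀ {x y}, G x y → G y x
  lt : ∀ {x y}, G x y → x < n
  noFiveCycle : NoFiveCycle G
  not_adj_pq : ¬ G p q
  not_common_pq : ∀ x, G p x → ¬ G x q
  not_path_pq : ∀ x y, G p x → G x y → ¬ G y q
  not_adj_pr : ¬ G p r
  not_common_pr : ∀ x, G p x → ¬ G x r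
  not_adj_qr : ¬ G q r

/-- Gluing two blocks to the vertices `p` and `q` preserves the invariants. -/
theorem IsTubeGraph.glue {n : ℕ} {G G' : ℕ → ℕ → Prop} {p q r : ℕ} (h : IsTubeGraph n G p q r)
    (hp : p < n) (hq : q < n) (hr : r < n) (hpq : p ≠ q) (hpr : p ≠ r) (hqr : q ≠ r)
    (hG' : ∀ x y, G' x y ↔ G x y ∨ IsTriangulationOn.BlockEdge n p q x y ∨
      IsTriangulationOn.BlockEdge n p q y x) : IsTubeGraph (n + 6) G' r (n + 4) (n + 2) := by
  have hs := @h.symm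
  have hl := @h.lt
  have hl' : ∀ x y, G x y → y < n := fun x y hxy => h.lt (h.symm hxy)
  have g1 := h.not_adj_pq
  have g2 := h.not_common_pq
  have g3 := h.not_path_pq
  have g4 := h.not_adj_pr
  have g5 := h.not_common_pr
  have g6 := h.not_adj_qr
  have b1 : ∀ y, G' (n + 1) y → y = p ∨ y = q ∨ n + 2 ≤ y := by
    intro y hy
    rw [hG'] at hy
    unfold IsTriangulationOn.BlockEdge at hy
    grind (splits := 30)
  have b2 : ∀ y, G' (n + 2) y → y = q ∨ y = n + 1 ∨ y = n + 3 := by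
    intro y hy
    rw [hG'] at hy
    unfold IsTriangulationOn.BlockEdge at hy
    grind (splits := 30)
  have b3 : ∀ y, G' (n + 3) y → y = q ∨ y = n + 1 ∨ y = n + 2 := by
    intro y hy
    rw [hG'] at hy
    unfold IsTriangulationOn.BlockEdge at hy
    grind (splits := 30)
  have b4 : ∀ y, G' (n + 4) y → y = p ∨ y = n + 1 ∨ y = n + 5 := by
    intro y hy
    rw [hG'] at hy
    unfold IsTriangulationOn.BlockEdge at hy
    grind (splits := 30)
  have b5 : ∀ y, G' (n + 5) y → y = p ∨ y = n + 1 ∨ y = n + 4 := by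
    intro y hy
    rw [hG'] at hy
    unfold IsTriangulationOn.BlockEdge at hy
    grind (splits := 30)
  have b0 : ∀ x y, G' x y → x < n → y < n → G x y := by
    intro x y hxy hx hy
    rw [hG'] at hxy
    unfold IsTriangulationOn.BlockEdge at hxy
    grind (splits := 30)
  have bx : ∀ x y, G' x y → x < n → y < n ∨ (x = p ∧ (y = n + 1 ∨ y = n + 4 ∨ y = n + 5)) ∨
      (x = q ∧ (y = n + 1 ∨ y = n + 2 ∨ y = n + 3)) := by
    intro x y hxy hx
    rw [hG'] at hxy
    unfold IsTriangulationOn.BlockEdge at hxy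
    grind (splits := 30)
  have bs : ∀ x y, G' x y → G' y x := by
    intro x y hxy
    rw [hG'] at hxy ⊢
    have := @hs x y
    tauto
  have bl : ∀ x y, G' x y → x < n ∨ x = n + 1 ∨ x = n + 2 ∨ x = n + 3 ∨ x = n + 4 ∨ x = n + 5 := by
    intro x y hxy
    rw [hG'] at hxy
    unfold IsTriangulationOn.BlockEdge at hxy
    grind (splits := 30)
  refine ⟨@bs, ?_, ?_, ?_, ?_, ?_, ?_, ?_, ?_⟩
  · intro x y hxy
    have := bl x y hxy
    omega
  · refine NoFiveCycle.of_max fun v a b c d hn ha hb hc hd h1 h2 h3 h4 h5 => ?_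
    rcases bl _ _ h1 with hv | rfl | rfl | rfl | rfl | rfl
    · refine h.noFiveCycle v a b c d ?_ (b0 _ _ h1 ?_ ?_) (b0 _ _ h2 ?_ ?_) (b0 _ _ h3 ?_ ?_)
        (b0 _ _ h4 ?_ ?_) (b0 _ _ h5 ?_ ?_)
      · rw [List.nodup_cons]
        refine ⟨?_, hn⟩
        simp only [List.mem_cons, List.not_mem_nil, or_false]
        omega
      all_goals omega
    all_goals
      have h5' := bs _ _ h5
      have h4' := bs _ _ h4
      simp only [List.nodup_cons, List.mem_cons, List.not_mem_nil, or_false, not_or,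
        not_false_eq_true, List.nodup_nil, and_true] at hn
    -- Largest vertex `n + 1`: its neighbours on the cycle are `p` and `q`, and the rest is a path
    -- of length three between them in the old graph.
    · have hbn : b < n := by have := bl _ _ h3; omega
      have hcn : c < n := by have := bl _ _ h4; omega
      have h3' := b0 _ _ h3 hbn hcn
      rcases b1 _ h1 with rfl | rfl | e1 <;> rcases b1 _ h5' with rfl | rfl | e2 <;>
        first
        | omega
        | exact g3 _ _ (b0 _ _ h2 (by omega) hbn) h3' (b0 _ _ h4 hcn (by omega))
        | exact g3 _ _ (b0 _ _ h4' (by omega) hcn) (hs h3') (hs (b0 _ _ h2 (by omega) hbn))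
    -- For `n + 2` and `n + 3`, the cycle cannot fit in the four vertices of the block, so it would
    -- have to return through the old graph from `q` to `p` by too short a path.
    · have := b0 _ _ h3
      have := bx _ _ h3
      have := b1 b
      have := b1 c
      grind (splits := 30)
    · have := b0 _ _ h3
      have := bx _ _ h3
      have := b1 b
      have := b1 c
      grind (splits := 30)
    · grind (splits := 30)
    · grind (splits := 30)
  · intro h1
    have := b4 _ (bs _ _ h1)
    omega
  · intro x h1 h2
    have := b4 _ (bs _ _ h2)
    have := bx _ _ h1 hr
    grind
  -- A path of length three from `r` to `n + 4` enters the new vertices from `p` or `q`. Via `p` it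
  -- contradicts distance at least three from `r`; via `q` it must continue through `n + 1`, which
  -- would make `q` and `r` adjacent.
  · intro x y h1 h2 h3
    have := b4 _ (bs _ _ h3)
    have := bx _ _ h1 hr
    have := b0 _ _ h1 hr
    have := b0 x y h2
    have := bs _ _ h2
    have := b1 x
    grind
  · intro h1
    have := b2 _ (bs _ _ h1)
    omega
  · intro x h1 h2
    have := b2 _ (bs _ _ h2)
    have := bx _ _ h1 hr
    grind
  · intro h1
    have := b4 _ h1
    omega

/-! ### The hub colouring. -/

/-- The colour of the edge `x y`: edges that meet a hub receive the colour of their largest hub, the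
other edges have a colour of their own. -/
def edgeColor (H : Finset ℕ) (x y : ℕ) : ℕ × ℕ :=
  if x ∈ H ∧ (y ∈ H → y ≤ x) then (x, x) else if y ∈ H then (y, y) else (max x y, min x y)

theorem edgeColor_comm (H : Finset ℕ) (x y : ℕ) : edgeColor H x y = edgeColor H y x := by
  unfold edgeColor
  rw [max_comm, min_comm]
  grind

theorem edgeColor_fst_lt {H : Finset ℕ} {n x y : ℕ} (hx : x < n) (hy : y < n) :
    (edgeColor H x y).1 < n := by
  unfold edgeColor
  split_ifs
  · exact hx
  · exact hy
  · exact max_lt hx hy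

/-- New hubs receive larger labels than all existing vertices, so old edges keep their colours. -/
theorem edgeColor_insert {H : Finset ℕ} {n x y : ℕ} (hx : x < n) (hy : y < n) :
    edgeColor (insert n H) x y = edgeColor H x y := by
  unfold edgeColor
  simp [hx.ne, hy.ne]

theorem edgeColor_hub {H : Finset ℕ} {x y : ℕ} (hx : x ∈ H) (hy : y ∈ H → y ≤ x) :
    edgeColor H x y = (x, x) := if_pos ⟨hx, hy⟩

theorem edgeColor_of_notMem {H : Finset ℕ} {x y : ℕ} (hx : x ∉ H) (hy : y ∉ H) (hxy : y < x) :
    edgeColor H x y = (x, y) := by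
  simp [edgeColor, hx, hy, hxy.le]

/-- Adjacency of vertices that are not hubs. -/
def NonHubAdj (F : Finset (ℕ × ℕ × ℕ)) (H : Finset ℕ) (x y : ℕ) : Prop :=
  SideAdj F x y ∧ x ∉ H ∧ y ∉ H

/-- A triangulation with a set `H` of hubs such that there is no five-cycle without hubs, and a set
`C` of colours that occur in the colouring `edgeColor H`. -/
structure IsHubbed (n : ℕ) (F : Finset (ℕ × ℕ × ℕ)) (H : Finset ℕ) (C : Finset (ℕ × ℕ)) :
    Prop where
  tri : IsTriangulationOn n F
  hub_lt : ∀ x ∈ H, x < n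
  noFiveCycle : NoFiveCycle (NonHubAdj F H)
  realized : ∀ c ∈ C, ∃ x y, SideAdj F x y ∧ edgeColor H x y = c

namespace IsHubbed

variable {n : ℕ} {F : Finset (ℕ × ℕ × ℕ)} {H : Finset ℕ} {C : Finset (ℕ × ℕ)}

theorem fst_lt (h : IsHubbed n F H C) {c : ℕ × ℕ} (hc : c ∈ C) : c.1 < n := by
  obtain ⟨x, y, ⟨w, hw⟩, rfl⟩ := h.realized c hc
  exact edgeColor_fst_lt (h.tri.lt hw) (h.tri.lt_snd hw)

/-- Subdividing a face by a new hub. -/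
theorem subdivide_hub (h : IsHubbed n F H C) {z p q r s : ℕ} (h₀ : (z, p, q) ∈ F)
    (h₁ : (z, q, r) ∈ F) (h₂ : (z, r, s) ∈ F) (hp : [p, q, r, s].Nodup) :
    ∃ F', IsHubbed (n + 1) F' (insert n H) (insert (n, n) C) ∧
      (z, p, n) ∈ F' ∧ (z, n, q) ∈ F' ∧ (z, q, r) ∈ F' ∧ [p, n, q, r].Nodup := by
  have l1 := h.tri.lt_snd h₀
  have l2 := h.tri.lt_snd h₁
  have l3 := h.tri.lt_snd h₂
  simp only [List.nodup_cons, List.mem_cons, List.not_mem_nil, or_false, not_or,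
    not_false_eq_true, List.nodup_nil, and_true] at hp
  obtain ⟨⟨d1, d2, d3⟩, ⟨d4, d5⟩, d6⟩ := hp
  obtain ⟨F', t, a, b, -, hO, hadj⟩ := h.tri.subdivide_link h₀
  refine ⟨F', ⟨t, ?_, ?_, ?_⟩, a, b, hO _ _ h₁ (Ne.symm d1), ?_⟩
  · intro x hx
    rcases Finset.mem_insert.1 hx with rfl | hx
    · omega
    · have := h.hub_lt x hx
      omega
  · have key : ∀ x y, NonHubAdj F' (insert n H) x y → NonHubAdj F H x y := by
      rintro x y ⟨h1, h2, h3⟩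
      rw [hadj] at h1
      rw [Finset.mem_insert, not_or] at h2 h3
      exact ⟨by tauto, h2.2, h3.2⟩
    intro a b c d e hn h1 h2 h3 h4 h5
    exact h.noFiveCycle a b c d e hn (key _ _ h1) (key _ _ h2) (key _ _ h3) (key _ _ h4) (key _ _ h5)
  · intro c hc
    rcases Finset.mem_insert.1 hc with rfl | hc
    · exact ⟨n, p, (hadj _ _).2 (by simp), edgeColor_hub (Finset.mem_insert_self _ _)
        fun _ => l1.le⟩
    · obtain ⟨x, y, hxy, rfl⟩ := h.realized c hc
      refine ⟨x, y, (hadj _ _).2 (.inl hxy), ?_⟩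
      obtain ⟨w, hw⟩ := hxy
      exact edgeColor_insert (h.tri.lt hw) (h.tri.lt_snd hw)
  · simp only [List.nodup_cons, List.mem_cons, List.not_mem_nil, or_false, not_or,
      not_false_eq_true, List.nodup_nil, and_true]
    omega

/-- Three consecutive faces at `z` are carried along because they later supply the five-cycle that
the triangulation must contain. -/
theorem subdivide_hubs (h : IsHubbed n F H C) {z p q r s : ℕ} (h₀ : (z, p, q) ∈ F)
    (h₁ : (z, q, r) ∈ F) (h₂ : (z, r, s) ∈ F) (hp : [p, q, r, s].Nodup) (m : ℕ) :
    ∃ F' H' C', IsHubbed (n + m) F' H' C' ∧ C'.card = C.card + m ∧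
      ∃ q' r' s', (z, p, q') ∈ F' ∧ (z, q', r') ∈ F' ∧ (z, r', s') ∈ F' ∧
        [p, q', r', s'].Nodup := by
  induction m with
  | zero => exact ⟨F, H, C, h, rfl, q, r, s, h₀, h₁, h₂, hp⟩
  | succ m ih =>
    obtain ⟨F', H', C', h', hC, q', r', s', e0, e1, e2, hn⟩ := ih
    obtain ⟨F'', h'', f0, f1, f2, hn'⟩ := h'.subdivide_hub e0 e1 e2 hn
    refine ⟨F'', _, _, h'', ?_, _, _, _, f0, f1, f2, hn'⟩
    rw [Finset.card_insert_of_notMem (fun hmem => (h'.fst_lt hmem).false), hC, add_assoc]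

/-- The edge-colouring of a hubbed triangulation has no rainbow five-cycle. -/
theorem exists_mem_rainbowFreeColorCounts (h : IsHubbed n F H C) {z p q r s : ℕ}
    (h₀ : (z, p, q) ∈ F) (h₁ : (z, q, r) ∈ F) (h₂ : (z, r, s) ∈ F) (hp : [p, q, r, s].Nodup) :
    ∃ k ∈ SimpleGraph.rainbowFreeColorCounts n (SimpleGraph.cycleGraph 5), C.card ≤ k := by
  classical
  have hn : 0 < n := (Nat.zero_le _).trans_lt (h.tri.lt h₀)
  let col : h.tri.graph.edgeSet → ℕ × ℕ := fun e =>
    Sym2.lift ⟨fun i j : Fin n => edgeColor H i j, fun i j => edgeColor_comm H i j⟩ e.1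
  let e := Finite.equivFin (Set.range col)
  refine ⟨Nat.card (Set.range col), ⟨h.tri.graph, h.tri.isPlaneTriangulation hn, ?_,
    fun x => e ⟨col x, x, rfl⟩, ?_, ?_⟩, ?_⟩
  · have hz := h.tri.lt h₀
    -- The boundary of the fan of three triangles at `z` is a five-cycle.
    let g : Fin 5 → Fin n := ![⟨z, hz⟩, ⟨p, h.tri.lt_snd h₀⟩, ⟨q, h.tri.lt_snd h₁⟩,
      ⟨r, h.tri.lt_snd h₂⟩, ⟨s, h.tri.lt_trd h₂⟩]
    have hg : ∀ i, h.tri.graph.Adj (g i) (g (i + 1)) := by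
      have a0 : SideAdj F z p := ⟨_, h₀⟩
      have a1 : SideAdj F p q := ⟨_, h.tri.rotate h₀⟩
      have a2 : SideAdj F q r := ⟨_, h.tri.rotate h₁⟩
      have a3 : SideAdj F r s := ⟨_, h.tri.rotate h₂⟩
      have a4 : SideAdj F s z := ⟨_, h.tri.rotate (h.tri.rotate h₂)⟩
      intro i
      fin_cases i
      exacts [a0, a1, a2, a3, a4]
    have hadj : ∀ i j, (SimpleGraph.cycleGraph 5).Adj i j → j = i + 1 ∨ i = j + 1 := by decide
    refine ⟨⟨⟨g, fun {i j} hij => ?_⟩, ?_⟩⟩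
    · rcases hadj i j hij with rfl | rfl
      exacts [hg i, (hg j).symm]
    · have d0 := h.tri.ne h₀
      have d1 := h.tri.ne h₁
      have d2 := h.tri.ne h₂
      have d3 := h.tri.ne (h.tri.rotate (h.tri.rotate h₂))
      have hnd : [z, p, q, r, s].Nodup := by
        rw [List.nodup_cons]
        exact ⟨by simp [d0, d1, d2, d3.symm], hp⟩
      have hnd' : (List.ofFn fun i => (g i : ℕ)).Nodup := by
        simpa [g, List.ofFn_succ] using hnd
      exact fun i j hij => List.nodup_ofFn.1 hnd' (congrArg Fin.val hij)
  · intro i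
    obtain ⟨⟨y, x, hx⟩, hy⟩ := e.surjective i
    subst hx
    exact ⟨x, hy⟩
  · rintro ⟨f, hf⟩
    have hinj : Function.Injective fun x => col (f.mapEdgeSet x) := by
      intro x y hxy
      apply hf
      simp only at hxy ⊢
      congr 2
    have hadj (i : Fin 5) : h.tri.graph.Adj (f i) (f (i + 1)) :=
      f.toHom.map_adj (by revert i; decide)
    by_cases hH : ∃ i, (f i : ℕ) ∈ H
    -- At the hub with the largest label on the cycle, both cycle edges have that hub's colour.
    · obtain ⟨i, hi, hmax⟩ := Finset.exists_max_image
        (Finset.univ.filter fun i => (f i : ℕ) ∈ H) (fun i => (f i : ℕ))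
        (by obtain ⟨i, hi⟩ := hH; exact ⟨i, by simpa using hi⟩)
      simp only [Finset.mem_filter, Finset.mem_univ, true_and] at hi hmax
      have a1 : (SimpleGraph.cycleGraph 5).Adj i (i + 1) := by clear hmax hi; revert i; decide
      have a2 : (SimpleGraph.cycleGraph 5).Adj i (i - 1) := by clear a1 hmax hi; revert i; decide
      have hne : s(i, i + 1) ≠ s(i, i - 1) := by
        clear hmax hi a1 a2
        revert i; decide
      refine hne (congrArg Subtype.val (@hinj ⟨s(i, i + 1), a1⟩ ⟨s(i, i - 1), a2⟩ ?_))
      change edgeColor H (f i) (f (i + 1)) = edgeColor H (f i) (f (i - 1))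
      rw [edgeColor_hub hi (hmax _), edgeColor_hub hi (hmax _)]
    · push Not at hH
      have hd (i j : Fin 5) (hij : i ≠ j) : (f i : ℕ) ≠ f j := fun e => hij (f.injective (Fin.ext e))
      refine h.noFiveCycle (f 0) (f 1) (f 2) (f 3) (f 4) ?_ ⟨hadj 0, hH _, hH _⟩
        ⟨hadj 1, hH _, hH _⟩ ⟨hadj 2, hH _, hH _⟩ ⟨hadj 3, hH _, hH _⟩ ⟨hadj 4, hH _, hH _⟩
      simp [hd]
  · rw [← Nat.card_eq_finsetCard]
    refine Nat.card_le_card_of_injective (fun c => (⟨c.1, ?_⟩ : Set.range col)) ?_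
    · obtain ⟨x, y, ⟨w, hw⟩, hc⟩ := h.realized c.1 c.2
      exact ⟨⟨s(⟨x, h.tri.lt hw⟩, ⟨y, h.tri.lt_snd hw⟩), ⟨w, hw⟩⟩, hc⟩
    · intro c d hcd
      exact Subtype.ext (Subtype.mk.inj hcd)

end IsHubbed

/-! ### Tubes and their extension. -/

/-- A hubbed triangulation that can be extended at the hub `z`, whose neighbours in cyclic order are
`p 0, …, p 8`. -/
structure IsTube (n : ℕ) (F : Finset (ℕ × ℕ × ℕ)) (H : Finset ℕ) (C : Finset (ℕ × ℕ)) (z : ℕ)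
    (p : Fin 9 → ℕ) : Prop extends IsHubbed n F H C where
  hub : z ∈ H
  injective : Function.Injective p
  link : ∀ i, (z, p i, p (i + 1)) ∈ F
  not_hub : ∀ i, p i ∉ H
  tubeGraph : IsTubeGraph n (NonHubAdj F H) (p 4) (p 0) (p 7)

/-- The colours of the edges of two new blocks and of the new hub `n`. -/
def blockColors (n p q : ℕ) : Finset (ℕ × ℕ) :=
  {(n, n), (n + 1, p), (n + 1, q), (n + 2, q), (n + 2, n + 1), (n + 3, q), (n + 3, n + 1),
    (n + 3, n + 2), (n + 4, p), (n + 4, n + 1), (n + 5, p), (n + 5, n + 1), (n + 5, n + 4)}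

theorem card_blockColors {n p q : ℕ} (hp : p < n) (hq : q < n) (hpq : p ≠ q) :
    (blockColors n p q).card = 13 := by
  have h1 := hp.ne
  have h2 := hq.ne
  have h3 : p ≠ n + 1 := by omega
  have h4 : q ≠ n + 1 := by omega
  have h5 : p ≠ n + 4 := by omega
  have h6 : q ≠ n + 2 := by omega
  unfold blockColors
  repeat rw [Finset.card_insert_of_notMem (by simp [*])]
  rw [Finset.card_singleton]

namespace IsTube

variable {n : ℕ} {F : Finset (ℕ × ℕ × ℕ)} {H : Finset ℕ} {C : Finset (ℕ × ℕ)} {z : ℕ}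
  {p : Fin 9 → ℕ}

/-- Extending the tube by one hexagon: six new vertices and thirteen new colours. -/
theorem extend (h : IsTube n F H C z p) :
    ∃ F' H' C' p', IsTube (n + 6) F' H' C' z p' ∧ C'.card = C.card + 13 := by
  have hlt (i : Fin 9) : p i < n := h.tri.lt_snd (h.link i)
  have hne {i j : Fin 9} (hij : i ≠ j) : p i ≠ p j := fun e => hij (h.injective e)
  have hz : z < n := h.hub_lt z h.hub
  have hge (m : ℕ) : n + m ∉ H := fun hm => by have := h.hub_lt _ hm; omega
  have hnd : [p 0, p 1, p 2, p 3, p 4].Nodup := by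
    simp [h.injective.eq_iff]
  obtain ⟨F', t, m1, m2, m3, m4, hO, a0, hzadj, hadj⟩ :=
    h.tri.glue_blocks (h.link 0) (h.link 1) (h.link 2) (h.link 3) hnd
  -- The surgery removes only edges at the hub `z`, so the non-hub graph just gains the block edges.
  have hG (x y : ℕ) : NonHubAdj F' (insert n H) x y ↔ NonHubAdj F H x y ∨
      IsTriangulationOn.BlockEdge n (p 4) (p 0) x y ∨
      IsTriangulationOn.BlockEdge n (p 4) (p 0) y x := by
    have hB (x y : ℕ) (hxy : IsTriangulationOn.BlockEdge n (p 4) (p 0) x y) :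
        x ≠ n ∧ x ∉ H ∧ y ≠ n ∧ y ∉ H := by
      have := h.not_hub 4
      have := h.not_hub 0
      have := hlt 4
      have := hlt 0
      rcases hxy with ⟨rfl, hy⟩ | ⟨rfl, hy⟩ | ⟨rfl, hy⟩ | ⟨rfl, hy⟩ | ⟨rfl, hy⟩ <;>
        refine ⟨by omega, hge _, by omega, ?_⟩ <;> grind
    have hcore : NonHubAdj F H x y ∨ IsTriangulationOn.BlockEdge n (p 4) (p 0) x y ∨
        IsTriangulationOn.BlockEdge n (p 4) (p 0) y x → x ≠ n ∧ x ∉ H ∧ y ≠ n ∧ y ∉ H := by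
      rintro (⟨⟨w, hw⟩, h2, h3⟩ | h1 | h1)
      · exact ⟨(h.tri.lt hw).ne, h2, (h.tri.lt_snd hw).ne, h3⟩
      · exact hB _ _ h1
      · have := hB _ _ h1
        tauto
    have hxz : x ∉ H → x ≠ z := fun hx e => hx (e ▸ h.hub)
    have hyz : y ∉ H → y ≠ z := fun hx e => hx (e ▸ h.hub)
    constructor
    · rintro ⟨h1, h2, h3⟩
      rw [Finset.mem_insert, not_or] at h2 h3
      rw [hadj x y (hxz h2.2) (hyz h3.2) h2.1 h3.1] at h1
      exact h1.imp_left fun h1 => ⟨h1, h2.2, h3.2⟩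
    · intro h1
      obtain ⟨e1, e2, e3, e4⟩ := hcore h1
      refine ⟨(hadj x y (hxz e2) (hyz e4) e1 e3).2 (h1.imp_left fun h1 => h1.1), ?_, ?_⟩ <;>
        simp [*]
  have hT := h.tubeGraph.glue (hlt 4) (hlt 0) (hlt 7) (hne (by decide)) (hne (by decide))
    (hne (by decide)) hG
  -- In the link of `z`, the vertices `p 1, p 2, p 3` have given way to `n + 2, n + 1, n + 4`.
  -- Starting at `n + 4` puts `p 7`, `n + 4`, `n + 2` at positions 4, 0, 7, as `IsTubeGraph.glue`
  -- requires.
  let p' : Fin 9 → ℕ := ![n + 4, p 4, p 5, p 6, p 7, p 8, p 0, n + 2, n + 1]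
  refine ⟨F', insert n H, C ∪ blockColors n (p 4) (p 0), p',
    ⟨⟨t, ?_, hT.noFiveCycle, ?_⟩, Finset.mem_insert_of_mem h.hub, ?_, ?_, ?_, hT⟩, ?_⟩
  · intro x hx
    rcases Finset.mem_insert.1 hx with rfl | hx
    · omega
    · have := h.hub_lt x hx
      omega
  · intro c hc
    rcases Finset.mem_union.1 hc with hc | hc
    · obtain ⟨x, y, hxy, rfl⟩ := h.realized c hc
      -- an edge at `z` either survives, or its colour is also that of the edge from `z` to `p 0`
      have hzed : ∀ y, SideAdj F z y →
          ∃ x' y', SideAdj F' x' y' ∧ edgeColor (insert n H) x' y' = edgeColor H z y := by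
        intro y hy
        have hyn : y < n := by
          obtain ⟨w, hw⟩ := hy
          exact h.tri.lt_snd hw
        by_cases hyp : y = p 1 ∨ y = p 2 ∨ y = p 3
        · have hyH : y ∉ H := by
            rcases hyp with rfl | rfl | rfl <;> exact h.not_hub _
          refine ⟨z, p 0, hzadj _ ⟨_, h.link 0⟩ (hne (by decide)) (hne (by decide))
            (hne (by decide)), ?_⟩
          rw [edgeColor_insert hz (hlt 0), edgeColor_hub h.hub (fun h' => absurd h' (h.not_hub 0)),
            edgeColor_hub h.hub (fun h' => absurd h' hyH)]
        · refine ⟨z, y, hzadj _ hy (by tauto) (by tauto) (by tauto), edgeColor_insert hz hyn⟩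
      by_cases hx : x = z
      · subst hx
        exact hzed y hxy
      by_cases hy : y = z
      · subst hy
        rw [edgeColor_comm]
        exact hzed x (h.tri.sideAdj_symm hxy)
      obtain ⟨w, hw⟩ := hxy
      have hxn := h.tri.lt hw
      have hyn := h.tri.lt_snd hw
      exact ⟨x, y, (hadj x y hx hy hxn.ne hyn.ne).2 (.inl ⟨w, hw⟩), edgeColor_insert hxn hyn⟩
    · have key : ∀ x y, y < x → IsTriangulationOn.BlockEdge n (p 4) (p 0) x y →
          ∃ x' y', SideAdj F' x' y' ∧ edgeColor (insert n H) x' y' = (x, y) := by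
        intro x y hyx hxy
        obtain ⟨h1, h2, h3⟩ := (hG x y).2 (.inr (.inl hxy))
        exact ⟨x, y, h1, edgeColor_of_notMem h2 h3 hyx⟩
      have := hlt 0
      have := hlt 4
      simp only [blockColors, Finset.mem_insert, Finset.mem_singleton] at hc
      rcases hc with rfl | hc
      · exact ⟨n, p 0, a0, edgeColor_hub (Finset.mem_insert_self _ _) fun _ => (hlt 0).le⟩
      · rcases hc with rfl | rfl | rfl | rfl | rfl | rfl | rfl | rfl | rfl | rfl | rfl | rfl <;>
          exact key _ _ (by omega) (by simp [IsTriangulationOn.BlockEdge])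
  · have : (List.ofFn p').Nodup := by
      have l (i : Fin 9) (m : ℕ) : n + m ≠ p i := by have := hlt i; omega
      simp [p', List.ofFn_succ, h.injective.eq_iff, l, fun i m => (l i m).symm]
    exact List.nodup_ofFn.1 this
  · have hold (i : Fin 9) (hi : 4 ≤ i) : (z, p i, p (i + 1)) ∈ F' :=
      hO _ _ (h.link i) (hne (by rintro rfl; simp at hi)) (hne (by rintro rfl; revert hi; decide))
        (hne (by rintro rfl; revert hi; decide)) (hne (by rintro rfl; revert hi; decide))
    intro i
    fin_cases i
    exacts [m4, hold 4 (by decide), hold 5 (by decide), hold 6 (by decide), hold 7 (by decide),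
      hold 8 (by decide), m1, m2, m3]
  · intro i
    rw [Finset.mem_insert, not_or]
    have hold (i : Fin 9) : p i ≠ n ∧ p i ∉ H := ⟨(hlt i).ne, h.not_hub i⟩
    have hnew (m : ℕ) (hm : m ≠ 0) : n + m ≠ n ∧ n + m ∉ H := ⟨by omega, hge m⟩
    fin_cases i
    exacts [hnew 4 (by decide), hold 4, hold 5, hold 6, hold 7, hold 8, hold 0,
      hnew 2 (by decide), hnew 1 (by decide)]
  · rw [Finset.card_union_of_disjoint, card_blockColors (hlt 4) (hlt 0) (hne (by decide))]
    rw [Finset.disjoint_left]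
    intro c hc hc'
    -- Old colours have first coordinate below `n`, new ones at least `n`.
    have := h.fst_lt hc
    simp only [blockColors, Finset.mem_insert, Finset.mem_singleton] at hc'
    rcases hc' with rfl | rfl | rfl | rfl | rfl | rfl | rfl | rfl | rfl | rfl | rfl | rfl | rfl <;>
      simp only at this <;> omega

theorem extend_iterate (h : IsTube n F H C z p) (m : ℕ) :
    ∃ F' H' C' p', IsTube (n + 6 * m) F' H' C' z p' ∧ C'.card = C.card + 13 * m := by
  induction m with
  | zero => exact ⟨F, H, C, p, h, rfl⟩
  | succ m ih =>
    obtain ⟨F', H', C', p', h', hC'⟩ := ih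
    obtain ⟨F'', H'', C'', p'', h'', hC''⟩ := h'.extend
    exact ⟨F'', H'', C'', p'', by rwa [mul_add, ← add_assoc], by omega⟩

end IsTube

/-! ### The base triangulation, verified by computation. -/

namespace BaseTube

/-- The cyclic order of the neighbours of each vertex in the triangulation from which the tubes
are grown: three hubs `0, 10, 15` and nine blocks, arranged so that the block cycles have length at
least six. -/
def rotations : List (List ℕ) :=
  [[1, 2, 3, 4, 5, 6, 7, 8, 9], [10, 11, 12, 2, 0, 9, 13, 14], [11, 15, 4, 16, 3, 0, 1, 12],
   [0, 2, 16, 4], [15, 17, 18, 5, 0, 3, 16, 2], [17, 10, 7, 19, 6, 0, 4, 18],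
   [0, 5, 19, 7], [10, 9, 20, 8, 0, 6, 19, 5], [9, 0, 7, 20],
   [7, 10, 14, 13, 1, 0, 8, 20], [21, 22, 23, 11, 1, 14, 9, 7, 5, 17, 24, 25], [1, 10, 23, 26, 22, 15, 2, 12],
   [1, 11, 2], [14, 1, 9], [10, 1, 13, 9],
   [22, 25, 17, 4, 2, 11], [2, 4, 3], [4, 15, 25, 27, 24, 10, 5, 18],
   [4, 17, 5], [5, 7, 6], [7, 9, 8],
   [22, 10, 25, 28], [10, 21, 28, 25, 15, 11, 26, 23], [10, 22, 26, 11],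
   [25, 10, 17, 27], [21, 10, 24, 27, 17, 15, 22, 28], [23, 22, 11],
   [25, 24, 17], [22, 21, 25]]

/-- The oriented triangles given by a vertex and two consecutive neighbours. -/
def triangleList : List (ℕ × ℕ × ℕ) :=
  (List.range 29).flatMap fun a =>
    ((rotations.getD a []).zip ((rotations.getD a []).rotate 1)).map fun p => (a, p.1, p.2)

/-- The oriented triangles of the base triangulation. -/
def triangles : Finset (ℕ × ℕ × ℕ) := triangleList.toFinset

/-- The hubs of the base triangulation. -/
def hubs : Finset ℕ := {0, 10, 15}

/-- The colours of the edges of the base triangulation. -/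
def colors : Finset (ℕ × ℕ) := (triangleList.map fun t => edgeColor hubs t.1 t.2.1).toFinset

/-- The successor of `b` in the rotation at `a`. -/
def succ (a b : ℕ) : ℕ :=
  (rotations.getD a []).getD (((rotations.getD a []).idxOf b + 1) % (rotations.getD a []).length) 0

/-- The neighbours of `a` that are not hubs, if `a` is not a hub itself. -/
def nonHubs (a : ℕ) : List ℕ :=
  if a ∈ hubs then [] else (rotations.getD a []).filter fun b => b ∉ hubs

theorem mem_triangles {t : ℕ × ℕ × ℕ} : t ∈ triangles ↔ t ∈ triangleList := List.mem_toFinset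

/-- These are the axioms of `IsTriangulationOn` that can be checked one triangle at a time; `succ`
makes the existential in `next` computable and yields `unique`. -/
theorem triangleList_local : ∀ t ∈ triangleList, t.1 < 29 ∧ t.1 ≠ t.2.1 ∧
    (t.2.1, t.2.2, t.1) ∈ triangleList ∧ (t.1, t.2.2, succ t.1 t.2.2) ∈ triangleList ∧
    succ t.1 t.2.1 = t.2.2 := by
  decide +kernel

/-- Fewer than 12 steps suffice, since 12 is the largest degree, attained at the hub `10`. -/
theorem triangleList_link : ∀ t ∈ triangleList, ∀ t' ∈ triangleList, t.1 = t'.1 →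
    ∃ k ∈ List.range 12, (succ t.1)^[k] t.2.1 = t'.2.1 := by
  decide +kernel

/-- A smaller neighbour for each nonzero vertex gives connectedness by strong induction. -/
theorem triangleList_parent : ∀ a ∈ List.range 29, a ≠ 0 →
    ∃ t ∈ triangleList, t.2.1 = a ∧ t.1 < a := by
  decide +kernel

theorem nodup_triangleList : triangleList.Nodup := by
  decide +kernel

theorem triangleList_nonHubs : ∀ t ∈ triangleList, t.1 ∉ hubs → t.2.1 ∉ hubs →
    t.2.1 ∈ nonHubs t.1 := by
  decide +kernel

/-- Searching along neighbour lists keeps the check small compared with all 5-tuples of vertices. -/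
theorem nonHubs_noFiveCycle : ∀ a ∈ List.range 29, ∀ b ∈ nonHubs a, ∀ c ∈ nonHubs b,
    ∀ d ∈ nonHubs c, ∀ e ∈ nonHubs d, a ∈ nonHubs e → ¬ [a, b, c, d, e].Nodup := by
  decide +kernel

/-- The vertices `3`, `8`, `6` play the roles of `p`, `q`, `r` in `IsTubeGraph`. -/
theorem nonHubs_far : 8 ∉ nonHubs 3 ∧ (∀ x ∈ nonHubs 3, 8 ∉ nonHubs x) ∧
    (∀ x ∈ nonHubs 3, ∀ y ∈ nonHubs x, 8 ∉ nonHubs y) ∧ 6 ∉ nonHubs 3 ∧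
    (∀ x ∈ nonHubs 3, 6 ∉ nonHubs x) ∧ 6 ∉ nonHubs 8 := by
  decide +kernel

/-- Nine blocks contribute 54 private colours and the three hubs one colour each. -/
theorem card_colors : colors.card = 57 := by
  decide +kernel

theorem isTriangulationOn : IsTriangulationOn 29 triangles := by
  have hloc {a b c : ℕ} (h : (a, b, c) ∈ triangles) := triangleList_local _ (mem_triangles.1 h)
  refine ⟨fun h => (hloc h).1, fun h => (hloc h).2.1, fun h => mem_triangles.2 (hloc h).2.2.1, ?_,
    fun h => ⟨_, mem_triangles.2 (hloc h).2.2.2.1⟩, ?_, ?_, ?_⟩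
  · intro a b c c' h h'
    exact (hloc h).2.2.2.2.symm.trans (hloc h').2.2.2.2
  · intro a b c b' c' h h'
    obtain ⟨k, -, hk⟩ := triangleList_link _ (mem_triangles.1 h) _ (mem_triangles.1 h') rfl
    have key : ∀ k, Relation.ReflTransGen (fun x y => (a, x, y) ∈ triangles) b ((succ a)^[k] b) ∧
        ∃ d, (a, (succ a)^[k] b, d) ∈ triangles := by
      intro k
      induction k with
      | zero => exact ⟨.refl, c, h⟩
      | succ k ih =>
        obtain ⟨h1, d, hd⟩ := ih
        have hs : succ a ((succ a)^[k] b) = d := (hloc hd).2.2.2.2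
        rw [Function.iterate_succ_apply', hs]
        exact ⟨h1.tail hd, _, mem_triangles.2 (hloc hd).2.2.2.1⟩
    rw [← show (succ a)^[k] b = b' from hk]
    exact (key k).1
  · intro S h0 hS a
    induction a using Nat.strong_induction_on with
    | _ a ih =>
      intro ha
      by_cases ha0 : a = 0
      · exact ha0 ▸ h0
      obtain ⟨⟨x, y, w⟩, ht, rfl, hx⟩ := triangleList_parent a (List.mem_range.2 ha) ha0
      exact hS _ _ _ (mem_triangles.2 ht) (ih x hx (hx.trans ha))
  · rw [triangles, List.toFinset_card_of_nodup nodup_triangleList]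
    decide +kernel

theorem mem_nonHubs {x y : ℕ} (h : NonHubAdj triangles hubs x y) : y ∈ nonHubs x := by
  obtain ⟨⟨w, hw⟩, hx, hy⟩ := h
  exact triangleList_nonHubs _ (mem_triangles.1 hw) hx hy

theorem isTube : IsTube 29 triangles hubs colors 0 ![8, 9, 1, 2, 3, 4, 5, 6, 7] := by
  have hC5 : NoFiveCycle (NonHubAdj triangles hubs) := by
    intro a b c d e hn h1 h2 h3 h4 h5
    obtain ⟨w, hw⟩ := h1.1
    exact nonHubs_noFiveCycle a (List.mem_range.2 (isTriangulationOn.lt hw)) b (mem_nonHubs h1)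
      c (mem_nonHubs h2) d (mem_nonHubs h3) e (mem_nonHubs h4) (mem_nonHubs h5) hn
  obtain ⟨f1, f2, f3, f4, f5, f6⟩ := nonHubs_far
  refine ⟨⟨isTriangulationOn, by decide +kernel, hC5, ?_⟩, by decide +kernel, by decide +kernel,
    by decide +kernel, by decide +kernel, ⟨?_, ?_, hC5, ?_, ?_, ?_, ?_, ?_, ?_⟩⟩
  · intro c hc
    obtain ⟨⟨x, y, w⟩, ht, rfl⟩ := List.mem_map.1 (List.mem_toFinset.1 hc)
    exact ⟨x, y, ⟨w, mem_triangles.2 ht⟩, rfl⟩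
  · exact fun h => ⟨isTriangulationOn.sideAdj_symm h.1, h.2.2, h.2.1⟩
  · rintro x y ⟨⟨w, hw⟩, -, -⟩
    exact isTriangulationOn.lt hw
  · exact fun h => f1 (mem_nonHubs h)
  · exact fun x h h' => f2 x (mem_nonHubs h) (mem_nonHubs h')
  · exact fun x y h h' h'' => f3 x (mem_nonHubs h) y (mem_nonHubs h') (mem_nonHubs h'')
  · exact fun h => f4 (mem_nonHubs h)
  · exact fun x h h' => f5 x (mem_nonHubs h) (mem_nonHubs h')
  · exact fun h => f6 (mem_nonHubs h)

end BaseTube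

/-! ### The final count. -/

theorem theorem3p1 (n r : ℕ) (hn : 119 ≤ n) (hr : r = (n + 7) % 18) :
    (39 * (n : ℝ) - 123 - 21 * (r : ℝ)) / 18 ≤
      (SimpleGraph.planarAntiRamsey n (SimpleGraph.cycleGraph 5) : ℝ) := by
  -- Since `29 + 7 = 2 * 18`, the quotient of `n + 7` by 18 is `k + 2`. Extensions are used in
  -- threes to match the residue modulo 18.
  obtain ⟨k, hk⟩ : ∃ k, n = 29 + 6 * (3 * k) + r := ⟨(n + 7) / 18 - 2, by omega⟩
  obtain ⟨F, H, C, p, h, hC⟩ := BaseTube.isTube.extend_iterate (3 * k)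
  have hp : [p 0, p 1, p 2, p 3].Nodup := by
    simp [h.injective.eq_iff]
  obtain ⟨F', H', C', h', hC', q, s, t, e0, e1, e2, hnd⟩ :=
    h.toIsHubbed.subdivide_hubs (h.link 0) (h.link 1) (h.link 2) hp r
  rw [← hk] at h'
  obtain ⟨m, hm, hle⟩ := h'.exists_mem_rainbowFreeColorCounts e0 e1 e2 hnd
  have hsup : m ≤ SimpleGraph.planarAntiRamsey n (SimpleGraph.cycleGraph 5) :=
    le_csSup (SimpleGraph.bddAbove_rainbowFreeColorCounts n _) hm
  rw [hC', hC, BaseTube.card_colors] at hle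
  have hle' : ((57 + 13 * (3 * k) + r : ℕ) : ℝ) ≤
      (SimpleGraph.planarAntiRamsey n (SimpleGraph.cycleGraph 5) : ℝ) := mod_cast hle.trans hsup
  -- After substituting for `n`, the claimed bound is `56 + 39k + r`, one less than the number of
  -- colours found.
  refine le_trans ?_ hle'
  rw [hk]
  push_cast
  linarith
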